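/- Let $-\infty<a<b<\infty$, $\Omega:=(a,b)$, $\delta_\Omega(x):=\operatorname{dist}(x,\partial\Omega)$. Let $0\le K,M\in L^2(\Omega)$ with $K\not\equiv0$, and put $M_a(x):=(x-a)M(x)$, $M_b(x):=(b-x)M(x)$. For $\alpha,\gamma,\lambda>0$ consider the problem $$-u''=K(x)u^{-\alpha}-\lambda M(x)u^{-\gamma}\ \text{ in }\Omega,\qquad u>0\ \text{ in }\Omega,\qquad u=0\ \text{ on }\partial\Omega. \tag{P}$$ A solution of (P) is a function $u\in C^1(\Omega)\cap C(\overline\Omega)$, positive in $\Omega$ and zero on $\partial\Omega$, with $\int_\Omega u'\varphi'=\int_\Omega\left(Ku^{-\alpha}-\lambda Mu^{-\gamma}\right)\varphi$ for all $\varphi\in C_c^\infty(\Omega)$. Let $P^\circ$ be the interior, in the $C^1$ norm, of the positive cone of $C^1_0(\overline\Omega):=\{u\in C^1(\overline\Omega):u=0\text{ on }\partial\Omega\}$. For $\alpha>\gamma>0$ let $\mathrm{(E)}_{\alpha,\gamma}$ be the assertion: there is $\lambda_0>0$ such that for every $0<\lambda\le\lambda_0$ problem (P) has a solution $u$; and this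 $u$ belongs to $W^{2,q}(\Omega)\cap P^\circ$ for some $q>1$ whenever $K\delta_\Omega^{-\alpha}\in L^r(\Omega)$ for some $r>1$. Then: (i) Suppose that $M\in L^p(\Omega)$ for some $2\le p\le\infty$, and let $p'$ be given by $1/p+1/p'=1$ ($p'=1$ if $p=\infty$). If $0<\gamma<1/p'$ and $$\max\left(\|M_a\|_{L^p(\Omega)},\|M_b\|_{L^p(\Omega)}\right)\le \frac{\gamma^\gamma}{(\gamma+1)^{\gamma+1}}\,\frac{(1-\gamma p')^{1/p'}}{(b-a)^{\gamma+1/p'}}\,\frac{\left(\int_a^bK\delta_\Omega\right)^{1+\gamma}}{\left(\int_a^bK\right)^{\gamma}},$$ then $\mathrm{(E)}_{\alpha,\gamma}$ holds for every $\alpha>\gamma$. (ii) If $$\max\left(\int_a^bM_a,\int_a^bM_b\right)<\int_a^bK\delta_\Omega,$$ then there is $\gamma_0>0$ such that $\mathrm{(E)}_{\alpha,\gamma}$ holds for every $\gamma\in(0,\gamma_0]$ and every $\alpha>\gamma$. -/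

import Mathlib

open MeasureTheory Set
open scoped ENNReal ContDiff

noncomputable section

namespace SingularBVP

/-- Lebesgue measure on the interval `Ω = (a, b)`. -/
def vol (a b : ℝ) : Measure ℝ := volume.restrict (Ioo a b)

/-- The distance to the boundary, `δ_Ω(x) = dist(x, ∂Ω)`, for `Ω = (a, b)`. -/
def bdist (a b x : ℝ) : ℝ := Metric.infDist x (frontier (Ioo a b))

/-- `φ ∈ C_c^∞(Ω)` for `Ω = (a, b)`. -/
structure IsTestFunction (a b : ℝ) (φ : ℝ → ℝ) : Prop where
  smooth : ContDiff ℝ ∞ φ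
  compact_support : HasCompactSupport φ
  support_subset : tsupport φ ⊆ Ioo a b

/-- `u ∈ C¹(Ω) ∩ C(Ω̄)` is a solution, in the sense of distributions, of
`-u'' = K u^(-α) - lam M u^(-γ)` in `Ω = (a, b)`, `u > 0` in `Ω`, `u = 0` on `∂Ω`. -/
structure IsSolution (a b : ℝ) (K M : ℝ → ℝ) (α γ lam : ℝ) (u : ℝ → ℝ) : Prop where
  contDiffOn : ContDiffOn ℝ 1 u (Ioo a b)
  continuousOn : ContinuousOn u (Icc a b)
  pos : ∀ x ∈ Ioo a b, 0 < u x
  left_eq_zero : u a = 0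
  right_eq_zero : u b = 0
  weak : ∀ φ : ℝ → ℝ, IsTestFunction a b φ →
    ∫ x in Ioo a b, deriv u x * deriv φ x =
      ∫ x in Ioo a b, (K x * u x ^ (-α) - lam * M x * u x ^ (-γ)) * φ x

/-- `g` is the weak derivative of `f` on `(a, b)`. -/
structure HasWeakDeriv (a b : ℝ) (f g : ℝ → ℝ) : Prop where
  locallyIntegrable : LocallyIntegrableOn f (Ioo a b)
  locallyIntegrable_deriv : LocallyIntegrableOn g (Ioo a b)
  integral_eq : ∀ φ : ℝ → ℝ, IsTestFunction a b φ →
    ∫ x in Ioo a b, f x * deriv φ x = - ∫ x in Ioo a b, g x * φ x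

/-- `u` belongs to the Sobolev space `W^{2,q}(Ω)`, `Ω = (a, b)`. -/
def MemW2 (a b : ℝ) (q : ℝ≥0∞) (u : ℝ → ℝ) : Prop :=
  MemLp u q (vol a b) ∧
    ∃ u₁ u₂ : ℝ → ℝ, MemLp u₁ q (vol a b) ∧ MemLp u₂ q (vol a b) ∧
      HasWeakDeriv a b u u₁ ∧ HasWeakDeriv a b u₁ u₂

/-- The space `C¹₀(Ω̄)` of the `C¹` functions on `[a, b]` which vanish at `a` and `b`. A function
`v` is represented by the pair `(v, v')` of continuous functions on `[a, b]`, so that the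
topology inherited from the product is the one of the `C¹` norm. -/
def C1Zero (a b : ℝ) : Set (C(Icc a b, ℝ) × C(Icc a b, ℝ)) :=
  {p | (∀ x : Icc a b, (x : ℝ) = a ∨ (x : ℝ) = b → p.1 x = 0) ∧
    ∀ x : Icc a b,
      HasDerivWithinAt (Function.extend Subtype.val p.1 0) (p.2 x) (Icc a b) (x : ℝ)}

/-- The positive cone of `C¹₀(Ω̄)`. -/
def posCone (a b : ℝ) : Set (C1Zero a b) := {p | ∀ x : Icc a b, 0 ≤ p.1.1 x}

/-- `u ∈ P°`, the interior in `C¹₀(Ω̄)` of its positive cone. -/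
def MemPInt (a b : ℝ) (u : ℝ → ℝ) : Prop :=
  ∃ p ∈ interior (posCone a b), ∀ x : Icc a b, p.1.1 x = u x

/-- The Hölder conjugate `p'` of `p`, with `p' = 1` for `p = ∞`, as a real number (`1 < p`). -/
def conj (p : ℝ≥0∞) : ℝ := (ENNReal.conjExponent p).toReal

/-- The constant `γ^γ / (γ+1)^(γ+1) * (1 - γ p')^(1/p') / (b-a)^(γ + 1/p')`. -/
def smallConst (γ : ℝ) (p : ℝ≥0∞) (a b : ℝ) : ℝ :=
  γ ^ γ / (γ + 1) ^ (γ + 1) *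
    ((1 - γ * conj p) ^ (1 / conj p) / (b - a) ^ (γ + 1 / conj p))

/-- There is `lam₀ > 0` such that for all `0 < lam ≤ lam₀` the problem has a solution `u`, which
is in `W^{2,q}(Ω) ∩ P°` for some `q > 1` whenever `K δ_Ω^(-α) ∈ L^r(Ω)` for some `r > 1`. -/
def SolvableForSmall (a b : ℝ) (K M : ℝ → ℝ) (α γ : ℝ) : Prop :=
  ∃ lam₀ : ℝ, 0 < lam₀ ∧ ∀ lam : ℝ, 0 < lam → lam ≤ lam₀ →
    ∃ u : ℝ → ℝ, IsSolution a b K M α γ lam u ∧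
      ((∃ r : ℝ≥0∞, 1 < r ∧ MemLp (fun x => K x * bdist a b x ^ (-α)) r (vol a b)) →
        ∃ q : ℝ≥0∞, 1 < q ∧ MemW2 a b q u ∧ MemPInt a b u)

end SingularBVP

end

namespace SingularBVP

/-! Write `δ` for the distance to the boundary and `G` for the Dirichlet Green operator of `-u''`.
The one property of `M` on which the construction rests is `M δ^(-γ) ∈ L^s` for some `s > 1`, which
follows by Hölder from `M ∈ L^p` and `γ < 1/p'` (`exists_memLp_mul_wt`).

The Green function satisfies `δ(x) δ(t) / (b - a) ≤ G(x, t) ≤ δ(x)`. Hence `G K₁ ≥ c₁ δ` for a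
nontrivial truncation `K₁ ≤ K`, while `G(M δ^(-γ)) ≤ C₂ δ`. A small multiple `v` of `G K₁ - σ G(M
δ^(-γ))` therefore satisfies `κ δ ≤ v ≤ 1`, and for small `lam` it is a subsolution
(`exists_subsolution`).

Cutting `u` off from below at `κ δ`, and the weights from above by multiples of powers of `δ`, makes
the right-hand side bounded and Lipschitz in `u`, so that shooting solves the problem
(`exists_eq_greenPot`). The maximum principle gives, uniformly in the truncation, `κ δ ≤ u` and `u ≤
η + η^(-α) G K` for every `η > 0` (`exists_approx`). The lower bound tames the singular terms and
yields local compactness; the upper bound yields continuity at the boundary, where `G K` vanishes.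
The limit solves the problem (`exists_greenRep_solution`).

If moreover `K δ^(-α) ∈ L^r`, then `u ≥ κ δ` puts the right-hand side in `L^q` with `q = min r s`.
Then `u ∈ W^{2,q}`, its derivative is continuous up to the boundary, and `u ≥ κ δ` places `u` in the
interior of the cone.

All equations are kept in integral form (`GreenRep`), which is stable under pointwise limits and
restriction to subintervals. -/

/-- The Green function of `-u''` on `(c, d)` with Dirichlet boundary conditions (for `x, t` in
`[c, d]`). -/
noncomputable def green (c d x t : ℝ) : ℝ := (x - c) * (d - t) / (d - c) - max (x - t) 0

/-! ### Estimates for the Green function -/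

theorem continuous_green (c d x : ℝ) : Continuous (green c d x) := by
  unfold green; fun_prop

theorem green_eq_of_le {c d x t : ℝ} (h : x ≤ t) : green c d x t = (x - c) * (d - t) / (d - c) := by
  rw [green, max_eq_right (by linarith), sub_zero]

theorem green_eq_of_ge {c d x t : ℝ} (hcd : c < d) (h : t ≤ x) :
    green c d x t = (t - c) * (d - x) / (d - c) := by
  have : d - c ≠ 0 := by linarith
  rw [green, max_eq_left (by linarith)]
  field_simp
  ring

theorem green_left {c d t : ℝ} (ht : c ≤ t) : green c d c t = 0 := by
  simp [green_eq_of_le ht]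

theorem green_right {c d t : ℝ} (hcd : c < d) (ht : t ≤ d) : green c d d t = 0 := by
  simp [green_eq_of_ge hcd ht]

theorem green_nonneg {c d x t : ℝ} (hcd : c < d) (hx : x ∈ Icc c d) (ht : t ∈ Icc c d) :
    0 ≤ green c d x t := by
  obtain ⟨hx1, hx2⟩ := hx
  obtain ⟨ht1, ht2⟩ := ht
  rcases le_total x t with h | h
  · rw [green_eq_of_le h]
    exact div_nonneg (mul_nonneg (by linarith) (by linarith)) (by linarith)
  · rw [green_eq_of_ge hcd h]
    exact div_nonneg (mul_nonneg (by linarith) (by linarith)) (by linarith)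

theorem green_le_min {c d x t : ℝ} (hcd : c < d) (hx : x ∈ Icc c d) (ht : t ∈ Icc c d) :
    green c d x t ≤ min (x - c) (d - x) := by
  obtain ⟨hx1, hx2⟩ := hx
  obtain ⟨ht1, ht2⟩ := ht
  have h0 : 0 < d - c := by linarith
  rcases le_total x t with h | h
  · rw [green_eq_of_le h, le_min_iff, div_le_iff₀ h0, div_le_iff₀ h0]
    constructor <;> nlinarith
  · rw [green_eq_of_ge hcd h, le_min_iff, div_le_iff₀ h0, div_le_iff₀ h0]
    constructor <;> nlinarith

/-- Hopf's lemma at the level of the kernel: it makes the potential of a nontrivial nonnegative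
function dominate a multiple of the distance to the boundary. -/
theorem min_mul_min_le_green {c d x t : ℝ} (hcd : c < d) (hx : x ∈ Icc c d) (ht : t ∈ Icc c d) :
    min (x - c) (d - x) * min (t - c) (d - t) / (d - c) ≤ green c d x t := by
  obtain ⟨hx1, hx2⟩ := hx
  obtain ⟨ht1, ht2⟩ := ht
  have h0 : 0 < d - c := by linarith
  rcases le_total x t with h | h
  · rw [green_eq_of_le h]
    exact div_le_div_of_nonneg_right (mul_le_mul (min_le_left _ _) (min_le_right _ _)
      (le_min (by linarith) (by linarith)) (by linarith)) h0.le
  · rw [green_eq_of_ge hcd h, mul_comm]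
    exact div_le_div_of_nonneg_right (mul_le_mul (min_le_left _ _) (min_le_right _ _)
      (le_min (by linarith) (by linarith)) (by linarith)) h0.le

/-- The slope in `x` is `(d - t) / (d - c)` before `t` and that number minus `1` after it; both lie
in `[-1, 1]`. -/
theorem abs_green_sub_green_le {c d x y t : ℝ} (hcd : c < d) (ht : t ∈ Icc c d) :
    |green c d x t - green c d y t| ≤ |x - y| := by
  wlog hxy : y ≤ x generalizing x y
  · rw [abs_sub_comm, abs_sub_comm x y]
    exact this (le_of_not_ge hxy)
  obtain ⟨ht1, ht2⟩ := ht
  have h0 : 0 < d - c := by linarith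
  have hr0 : 0 ≤ (d - t) / (d - c) := div_nonneg (by linarith) h0.le
  have hr1 : (d - t) / (d - c) ≤ 1 := by rw [div_le_one h0]; linarith
  have e : green c d x t - green c d y t =
      (x - y) * ((d - t) / (d - c)) - (max (x - t) 0 - max (y - t) 0) := by
    unfold green; ring
  have h1 : 0 ≤ max (x - t) 0 - max (y - t) 0 :=
    sub_nonneg.2 (max_le_max (by linarith) le_rfl)
  have h2 : max (x - t) 0 - max (y - t) 0 ≤ x - y := by
    rcases le_total (y - t) 0 with h | h
    · rw [max_eq_right h, sub_zero]
      exact max_le (by linarith) (by linarith)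
    · rw [max_eq_left h, max_eq_left (by linarith)]; linarith
  rw [e, abs_of_nonneg (show 0 ≤ x - y by linarith), abs_le]
  constructor
  · nlinarith [mul_nonneg (show 0 ≤ x - y by linarith) hr0]
  · nlinarith [mul_le_mul_of_nonneg_left hr1 (show 0 ≤ x - y by linarith)]

theorem abs_green_le {c d x t : ℝ} (hcd : c < d) (hx : x ∈ Icc c d) (ht : t ∈ Icc c d) :
    |green c d x t| ≤ d - c := by
  rw [abs_of_nonneg (green_nonneg hcd hx ht)]
  exact (green_le_min hcd hx ht).trans ((min_le_left _ _).trans (by linarith [hx.2]))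

theorem intervalIntegrable_green_mul {h : ℝ → ℝ} {c d p q : ℝ}
    (hh : IntervalIntegrable h volume c d) (x : ℝ) :
    IntervalIntegrable (fun t => green p q x t * h t) volume c d :=
  hh.continuousOn_mul (continuous_green p q x).continuousOn

/-! ### Green's representation formula and the maximum principle -/

/-- `u` solves `-u'' = h` on `[c, d]`, in the form of Green's representation formula. -/
def GreenRep (c d : ℝ) (h u : ℝ → ℝ) : Prop :=
  ∀ x ∈ Icc c d, u x = ((d - x) * u c + (x - c) * u d) / (d - c) +
    ∫ t in c..d, green c d x t * h t

/-- The solution of `-u'' = h` on `(c, d)` with zero boundary values. -/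
noncomputable def greenPot (c d : ℝ) (h : ℝ → ℝ) (x : ℝ) : ℝ := ∫ t in c..d, green c d x t * h t

theorem greenPot_left {c d : ℝ} (hcd : c < d) (h : ℝ → ℝ) : greenPot c d h c = 0 := by
  unfold greenPot
  rw [intervalIntegral.integral_congr (g := fun _ => 0), intervalIntegral.integral_zero]
  intro t ht
  rw [uIcc_of_le hcd.le] at ht
  simp [green_left ht.1]

theorem greenPot_right {c d : ℝ} (hcd : c < d) (h : ℝ → ℝ) : greenPot c d h d = 0 := by
  unfold greenPot
  rw [intervalIntegral.integral_congr (g := fun _ => 0), intervalIntegral.integral_zero]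
  intro t ht
  rw [uIcc_of_le hcd.le] at ht
  simp [green_right hcd ht.2]

theorem greenRep_greenPot {c d : ℝ} (hcd : c < d) (h : ℝ → ℝ) :
    GreenRep c d h (greenPot c d h) := by
  intro x _
  rw [greenPot_left hcd, greenPot_right hcd]
  simp [greenPot]

theorem GreenRep.sub {c d : ℝ} {h₁ h₂ u₁ u₂ : ℝ → ℝ} (H₁ : GreenRep c d h₁ u₁)
    (H₂ : GreenRep c d h₂ u₂) (hh₁ : IntervalIntegrable h₁ volume c d)
    (hh₂ : IntervalIntegrable h₂ volume c d) :
    GreenRep c d (fun t => h₁ t - h₂ t) (fun x => u₁ x - u₂ x) := by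
  intro x hx
  have e : ∫ t in c..d, green c d x t * (h₁ t - h₂ t) =
      (∫ t in c..d, green c d x t * h₁ t) - ∫ t in c..d, green c d x t * h₂ t := by
    rw [← intervalIntegral.integral_sub (intervalIntegrable_green_mul hh₁ x)
      (intervalIntegrable_green_mul hh₂ x)]
    simp only [mul_sub]
  simp only [e]
  rw [H₁ x hx, H₂ x hx]
  ring

/-- Green's representation formula is inherited by subintervals. -/
theorem GreenRep.mono {a b c d : ℝ} {h u : ℝ → ℝ} (H : GreenRep a b h u) (hac : a ≤ c)
    (hcd : c < d) (hdb : d ≤ b) (hh : IntervalIntegrable h volume a b) : GreenRep c d h u := by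
  intro x hx
  obtain ⟨hx1, hx2⟩ := hx
  have hab : a < b := by linarith
  have h0 : d - c ≠ 0 := by linarith
  have h0' : b - a ≠ 0 := by linarith
  -- The Green function of `(a, b)` minus its chord in `x` over `[c, d]`. For `t` outside `(c, d)`
  -- the kernel is affine in `x` on `[c, d]`, so the difference vanishes; for `t` inside, it is the
  -- Green function of `(c, d)`.
  set D : ℝ → ℝ := fun t => green a b x t -
    ((d - x) * green a b c t + (x - c) * green a b d t) / (d - c) with hD
  have hi := fun y => intervalIntegrable_green_mul (p := a) (q := b) hh y
  have e1 : ∫ t in a..b, D t * h t = (∫ t in a..b, green a b x t * h t) -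
      ((d - x) * (∫ t in a..b, green a b c t * h t) +
        (x - c) * ∫ t in a..b, green a b d t * h t) / (d - c) := by
    rw [← intervalIntegral.integral_const_mul, ← intervalIntegral.integral_const_mul,
      ← intervalIntegral.integral_add ((hi c).const_mul _) ((hi d).const_mul _),
      ← intervalIntegral.integral_div, ← intervalIntegral.integral_sub (hi x)
        ((((hi c).const_mul _).add ((hi d).const_mul _)).div_const _)]
    refine intervalIntegral.integral_congr fun t _ => ?_
    simp only [hD]
    ring
  have hDc : Continuous D := by
    have := continuous_green a b
    simp only [hD]
    fun_prop
  have hsub : ∀ p q : ℝ, a ≤ p → p ≤ q → q ≤ b → IntervalIntegrable (fun t => D t * h t)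
      volume p q := by
    intro p q hp hpq hq
    refine (hh.continuousOn_mul hDc.continuousOn).mono_set ?_
    rw [uIcc_of_le hpq, uIcc_of_le hab.le]
    exact Icc_subset_Icc hp hq
  have e2 : ∫ t in a..b, D t * h t = ∫ t in c..d, green c d x t * h t := by
    rw [← intervalIntegral.integral_add_adjacent_intervals (hsub a c le_rfl hac (by linarith))
      (hsub c b hac (by linarith) le_rfl),
      ← intervalIntegral.integral_add_adjacent_intervals (hsub c d hac hcd.le hdb)
      (hsub d b (by linarith) hdb le_rfl)]
    have z1 : ∫ t in a..c, D t * h t = 0 := by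
      rw [intervalIntegral.integral_congr (g := fun _ => 0), intervalIntegral.integral_zero]
      intro t ht
      rw [uIcc_of_le hac] at ht
      simp only [hD]
      rw [green_eq_of_ge hab (by linarith [ht.2]), green_eq_of_ge hab (by linarith [ht.2]),
        green_eq_of_ge hab (by linarith [ht.2])]
      field_simp
      ring
    have z2 : ∫ t in d..b, D t * h t = 0 := by
      rw [intervalIntegral.integral_congr (g := fun _ => 0), intervalIntegral.integral_zero]
      intro t ht
      rw [uIcc_of_le hdb] at ht
      simp only [hD]
      rw [green_eq_of_le (by linarith [ht.1]), green_eq_of_le (by linarith [ht.1]),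
        green_eq_of_le (by linarith [ht.1])]
      field_simp
      ring
    rw [z1, z2, zero_add, add_zero]
    refine intervalIntegral.integral_congr fun t ht => ?_
    rw [uIcc_of_le hcd.le] at ht
    simp only [hD]
    congr 1
    unfold green
    rw [max_eq_right (show c - t ≤ 0 by linarith [ht.1]),
      max_eq_left (show 0 ≤ d - t by linarith [ht.2])]
    field_simp
    ring
  have hxab := H x ⟨by linarith, by linarith⟩
  have hcab := H c ⟨by linarith, by linarith⟩
  have hdab := H d ⟨by linarith, by linarith⟩
  rw [← e2, e1]
  generalize (∫ t in a..b, green a b x t * h t) = Ix at *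
  generalize (∫ t in a..b, green a b c t * h t) = Ic at *
  generalize (∫ t in a..b, green a b d t * h t) = Id at *
  rw [hxab, hcab, hdab]
  field_simp
  ring

/-- The constant involves only the boundary values and a majorant of `|h|`, so it is uniform along a
sequence of problems with a common majorant and bounded solutions. -/
theorem GreenRep.abs_sub_le {c d : ℝ} {h u g : ℝ → ℝ} (H : GreenRep c d h u) (hcd : c < d)
    (hh : IntervalIntegrable h volume c d) (hg : IntervalIntegrable g volume c d)
    (hhg : ∀ t ∈ Ioo c d, |h t| ≤ g t) {x y : ℝ} (hx : x ∈ Icc c d) (hy : y ∈ Icc c d) :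
    |u x - u y| ≤ (|u d - u c| / (d - c) + ∫ t in c..d, g t) * |x - y| := by
  have h0 : 0 < d - c := by linarith
  have e : u x - u y = (x - y) * ((u d - u c) / (d - c)) +
      ∫ t in c..d, (green c d x t - green c d y t) * h t := by
    have : ∫ t in c..d, (green c d x t - green c d y t) * h t =
        (∫ t in c..d, green c d x t * h t) - ∫ t in c..d, green c d y t * h t := by
      rw [← intervalIntegral.integral_sub (intervalIntegrable_green_mul hh x)
        (intervalIntegrable_green_mul hh y)]
      simp only [sub_mul]
    rw [this, H x hx, H y hy]
    field_simp
    ring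
  have hb : |∫ t in c..d, (green c d x t - green c d y t) * h t| ≤
      ∫ t in c..d, |x - y| * g t := by
    rw [← Real.norm_eq_abs]
    refine intervalIntegral.norm_integral_le_of_norm_le hcd.le ?_ (hg.const_mul _)
    have hne : ∀ᵐ t : ℝ, t ≠ d := by simp [ae_iff]
    filter_upwards [hne] with t htd ht
    rw [Real.norm_eq_abs, abs_mul]
    exact mul_le_mul (abs_green_sub_green_le hcd ⟨ht.1.le, ht.2⟩)
      (hhg t ⟨ht.1, lt_of_le_of_ne ht.2 htd⟩) (abs_nonneg _) (abs_nonneg _)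
  rw [intervalIntegral.integral_const_mul] at hb
  rw [e]
  refine (abs_add_le _ _).trans ?_
  rw [abs_mul, abs_div, abs_of_pos h0]
  linarith

theorem GreenRep.continuousOn {c d : ℝ} {h u : ℝ → ℝ} (H : GreenRep c d h u) (hcd : c < d)
    (hh : IntervalIntegrable h volume c d) : ContinuousOn u (Icc c d) := by
  set C := |u d - u c| / (d - c) + ∫ t in c..d, |h t|
  have hL : ∀ x ∈ Icc c d, ∀ y ∈ Icc c d, |u x - u y| ≤ C * |x - y| := fun x hx y hy =>
    H.abs_sub_le hcd hh hh.abs (fun _ _ => le_rfl) hx hy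
  have : LipschitzOnWith C.toNNReal u (Icc c d) := by
    refine LipschitzOnWith.of_dist_le_mul fun x hx y hy => ?_
    rw [Real.dist_eq, Real.dist_eq]
    exact (hL x hx y hy).trans
      (mul_le_mul_of_nonneg_right (Real.le_coe_toNNReal C) (abs_nonneg _))
  exact this.continuousOn

/-- The maximum principle, relative to a level `η`. -/
theorem GreenRep.le_of_nonpos {a b η : ℝ} {h z : ℝ → ℝ} (H : GreenRep a b h z) (hab : a < b)
    (hh : IntervalIntegrable h volume a b) (ha : z a ≤ η) (hb : z b ≤ η)
    (hneg : ∀ t ∈ Ioo a b, η < z t → h t ≤ 0) : ∀ x ∈ Icc a b, z x ≤ η := by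
  intro x hx
  by_contra! hlt
  have hc := H.continuousOn hab hh
  have hS1 : IsCompact (Icc a x ∩ z ⁻¹' Iic η) :=
    isCompact_Icc.of_isClosed_subset
      ((hc.mono (Icc_subset_Icc le_rfl hx.2)).preimage_isClosed_of_isClosed isClosed_Icc isClosed_Iic)
      inter_subset_left
  have hS2 : IsCompact (Icc x b ∩ z ⁻¹' Iic η) :=
    isCompact_Icc.of_isClosed_subset
      ((hc.mono (Icc_subset_Icc hx.1 le_rfl)).preimage_isClosed_of_isClosed isClosed_Icc isClosed_Iic)
      inter_subset_left
  -- `(c, d)` is the component of `{z > η}` around `x`. There `h ≤ 0`, so Green's formula on `[c,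
  -- d]` bounds `z x` by a convex combination of `z c` and `z d`, both at most `η`.
  obtain ⟨c, ⟨⟨hac, hcx⟩, hzc⟩, hcmax⟩ := hS1.exists_isGreatest ⟨a, ⟨le_rfl, hx.1⟩, ha⟩
  obtain ⟨d, ⟨⟨hxd, hdb⟩, hzd⟩, hdmin⟩ := hS2.exists_isLeast ⟨b, ⟨hx.2, le_rfl⟩, hb⟩
  simp only [mem_preimage, mem_Iic] at hzc hzd
  have hcx' : c < x := lt_of_le_of_ne hcx (by rintro rfl; linarith)
  have hxd' : x < d := lt_of_le_of_ne hxd (by rintro rfl; linarith)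
  have hcd : c < d := hcx'.trans hxd'
  have hpos : ∀ t ∈ Ioo c d, η < z t := by
    intro t ht
    by_contra! hle
    rcases le_total t x with h' | h'
    · exact absurd (hcmax ⟨⟨hac.trans ht.1.le, h'⟩, hle⟩) (not_le.2 ht.1)
    · exact absurd (hdmin ⟨⟨h', ht.2.le.trans hdb⟩, hle⟩) (not_le.2 ht.2)
  have hr := H.mono hac hcd hdb hh x ⟨hcx, hxd⟩
  have hI : ∫ t in c..d, green c d x t * h t ≤ 0 := by
    rw [intervalIntegral.integral_of_le hcd.le, integral_Ioc_eq_integral_Ioo]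
    refine setIntegral_nonpos measurableSet_Ioo fun t ht => ?_
    exact mul_nonpos_of_nonneg_of_nonpos (green_nonneg hcd ⟨hcx, hxd⟩ ⟨ht.1.le, ht.2.le⟩)
      (hneg t ⟨by linarith [ht.1], by linarith [ht.2]⟩ (hpos t ht))
  have hA : ((d - x) * z c + (x - c) * z d) / (d - c) ≤ η := by
    rw [div_le_iff₀ (by linarith)]
    nlinarith
  linarith

/-! ### Differentiation and integration by parts -/

/-- Twice integrating: the Volterra kernel `x - t`. -/
theorem integral_sub_mul_eq {c x : ℝ} {h : ℝ → ℝ} (hh : IntervalIntegrable h volume c x) :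
    ∫ t in c..x, (x - t) * h t = ∫ s in c..x, ∫ t in c..s, h t := by
  have h1 : AbsolutelyContinuousOnInterval (fun t => x - t) c x :=
    (LipschitzOnWith.of_dist_le_mul (K := 1) (f := fun t => x - t) (s := uIcc c x) fun y _ z _ => by
      rw [Real.dist_eq, Real.dist_eq, show x - y - (x - z) = -(y - z) by ring, abs_neg]
      simp).absolutelyContinuousOnInterval
  have h2 := hh.absolutelyContinuousOnInterval_intervalIntegral (c := c) left_mem_uIcc
  have := h1.integral_mul_deriv_eq_deriv_mul h2
  simp only [sub_self, zero_mul, intervalIntegral.integral_same, mul_zero, zero_sub] at this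
  have e : ∫ t in c..x, (x - t) * deriv (fun s => ∫ v in c..s, h v) t =
      ∫ t in c..x, (x - t) * h t := by
    refine intervalIntegral.integral_congr_ae ?_
    filter_upwards [hh.ae_hasDerivAt_integral] with t ht htx
    rw [(ht (uIoc_subset_uIcc htx) c left_mem_uIcc).deriv]
  have hd : deriv (fun t => x - t) = fun _ => -1 := by
    ext t
    simp
  rw [← e, this, hd]
  simp only [neg_mul, one_mul, intervalIntegral.integral_neg, neg_neg]

theorem integral_max_sub_mul {c d x : ℝ} {h : ℝ → ℝ} (hh : IntervalIntegrable h volume c d)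
    (hx : x ∈ Icc c d) :
    ∫ t in c..d, max (x - t) 0 * h t = ∫ t in c..x, (x - t) * h t := by
  have hcd : c ≤ d := hx.1.trans hx.2
  have hcx : IntervalIntegrable h volume c x := hh.mono_set (by
    rw [uIcc_of_le hx.1, uIcc_of_le hcd]; exact Icc_subset_Icc le_rfl hx.2)
  have hxd : IntervalIntegrable h volume x d := hh.mono_set (by
    rw [uIcc_of_le hx.2, uIcc_of_le hcd]; exact Icc_subset_Icc hx.1 le_rfl)
  rw [← intervalIntegral.integral_add_adjacent_intervals (b := x)
    (hcx.continuousOn_mul (by fun_prop)) (hxd.continuousOn_mul (by fun_prop))]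
  have z : ∫ t in x..d, max (x - t) 0 * h t = 0 := by
    rw [intervalIntegral.integral_congr (g := fun _ => 0), intervalIntegral.integral_zero]
    intro t ht
    rw [uIcc_of_le hx.2] at ht
    simp [max_eq_right (show x - t ≤ 0 by linarith [ht.1])]
  rw [z, add_zero]
  refine intervalIntegral.integral_congr fun t ht => ?_
  rw [uIcc_of_le hx.1] at ht
  simp only [max_eq_left (show 0 ≤ x - t by linarith [ht.2])]

/-- The affine part of the kernel contributes a constant slope, and its Volterra part is a double
integral of `h`. One-sided derivatives at the endpoints are included, as needed for regularity up to
the boundary. -/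
theorem GreenRep.exists_deriv {c d : ℝ} {h u : ℝ → ℝ} (H : GreenRep c d h u) (hcd : c < d)
    (hh : IntervalIntegrable h volume c d) :
    ∃ B : ℝ, ∀ x ∈ Icc c d, HasDerivWithinAt u (B - ∫ t in c..x, h t) (Icc c d) x := by
  set J := ∫ t in c..d, (d - t) * h t
  set B := (u d - u c) / (d - c) + J / (d - c) with hB
  refine ⟨B, ?_⟩
  have hmul : IntervalIntegrable (fun t => (d - t) * h t) volume c d :=
    hh.continuousOn_mul (by fun_prop)
  have hcont : ContinuousOn (fun s => B - ∫ t in c..s, h t) (Icc c d) := by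
    have := intervalIntegral.continuousOn_primitive_interval' hh left_mem_uIcc
    rw [uIcc_of_le hcd.le] at this
    exact continuousOn_const.sub this
  have hu : ∀ x ∈ Icc c d, u x = u c + ∫ s in c..x, (B - ∫ t in c..s, h t) := by
    intro x hx
    have hcx : IntervalIntegrable h volume c x := hh.mono_set (by
      rw [uIcc_of_le hx.1, uIcc_of_le hcd.le]; exact Icc_subset_Icc le_rfl hx.2)
    have e : ∫ t in c..d, green c d x t * h t =
        (x - c) / (d - c) * J - ∫ s in c..x, ∫ t in c..s, h t := by
      rw [← integral_sub_mul_eq hcx, ← integral_max_sub_mul hh hx, ← intervalIntegral.integral_const_mul,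
        ← intervalIntegral.integral_sub (hmul.const_mul _) (hh.continuousOn_mul (by fun_prop))]
      refine intervalIntegral.integral_congr fun t _ => ?_
      simp only [green]
      ring
    have hpi : IntervalIntegrable (fun s => ∫ t in c..s, h t) volume c x :=
      (intervalIntegral.continuousOn_primitive_interval' hcx left_mem_uIcc).intervalIntegrable
    rw [H x hx, e, intervalIntegral.integral_sub intervalIntegrable_const hpi,
      intervalIntegral.integral_const, smul_eq_mul, hB]
    have : d - c ≠ 0 := by linarith
    field_simp
    ring
  intro x hx
  have hfd : HasDerivWithinAt (fun y => ∫ s in c..y, (B - ∫ t in c..s, h t))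
      (B - ∫ t in c..x, h t) (Icc c d) x := by
    have : Fact (x ∈ Icc c d) := ⟨hx⟩
    refine intervalIntegral.integral_hasDerivWithinAt_right (t := Icc c d) ?_ ?_ (hcont x hx)
    · exact (hcont.mono (by rw [uIcc_of_le hx.1]; exact Icc_subset_Icc le_rfl hx.2)).intervalIntegrable
    · exact ⟨Icc c d, self_mem_nhdsWithin, hcont.aestronglyMeasurable measurableSet_Icc⟩
  exact (hfd.const_add (u c)).congr hu (hu x hx)

/-- Integration by parts against an indefinite integral. -/
theorem integral_primitive_mul_deriv {c d B : ℝ} {h φ : ℝ → ℝ}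
    (hh : IntervalIntegrable h volume c d) (hφ : ContDiff ℝ 1 φ) (hc : φ c = 0) (hd : φ d = 0) :
    ∫ x in c..d, (B - ∫ t in c..x, h t) * deriv φ x = ∫ x in c..d, h x * φ x := by
  have h1 : AbsolutelyContinuousOnInterval φ c d :=
    hφ.contDiffOn.absolutelyContinuousOnInterval
  have h2 := hh.absolutelyContinuousOnInterval_intervalIntegral (c := c) left_mem_uIcc
  have h3 : ∫ x in c..d, (∫ t in c..x, h t) * deriv φ x = - ∫ x in c..d, h x * φ x := by
    rw [h2.integral_mul_deriv_eq_deriv_mul h1, hc, hd]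
    simp only [mul_zero, sub_self, zero_sub, neg_inj]
    refine intervalIntegral.integral_congr_ae ?_
    filter_upwards [hh.ae_hasDerivAt_integral] with t ht htx
    rw [(ht (uIoc_subset_uIcc htx) c left_mem_uIcc).deriv]
  have hφi : IntervalIntegrable (deriv φ) volume c d :=
    (hφ.continuous_deriv le_rfl).intervalIntegrable _ _
  have h4 : ∫ x in c..d, deriv φ x = 0 := by
    rw [intervalIntegral.integral_deriv_eq_sub (fun x _ => hφ.differentiable one_ne_zero x) hφi,
      hc, hd, sub_self]
  have hpi := intervalIntegral.continuousOn_primitive_interval' hh left_mem_uIcc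
  simp only [sub_mul]
  rw [intervalIntegral.integral_sub (hφi.const_mul B) (hφi.continuousOn_mul hpi),
    intervalIntegral.integral_const_mul, h4, h3]
  ring

/-! ### Shooting for a bounded, globally Lipschitz nonlinearity -/

theorem intervalIntegrable_of_bound {f : ℝ → ℝ} {C : ℝ} (hf : Measurable f)
    (hC : ∀ t, |f t| ≤ C) (p q : ℝ) : IntervalIntegrable f volume p q :=
  (intervalIntegrable_const (c := C)).mono_fun hf.aestronglyMeasurable
    (Filter.Eventually.of_forall fun t => by
      simpa only [Real.norm_eq_abs] using (hC t).trans (le_abs_self C))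

theorem continuous_volterra {h : ℝ → ℝ} {C : ℝ} (hm : Measurable h) (hC : ∀ t, |h t| ≤ C) (a : ℝ) :
    Continuous fun x => ∫ t in a..x, (x - t) * h t := by
  have hi := intervalIntegrable_of_bound hm hC
  have hti : ∀ p q, IntervalIntegrable (fun t => t * h t) volume p q := fun p q =>
    (hi p q).continuousOn_mul (by fun_prop)
  have e : (fun x => ∫ t in a..x, (x - t) * h t) =
      fun x => x * (∫ t in a..x, h t) - ∫ t in a..x, t * h t := by
    ext x
    rw [← intervalIntegral.integral_const_mul,
      ← intervalIntegral.integral_sub ((hi a x).const_mul x) (hti a x)]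
    simp only [sub_mul]
  rw [e]
  exact (continuous_id.mul (intervalIntegral.continuous_primitive hi a)).sub
    (intervalIntegral.continuous_primitive hti a)

section shooting

variable {a b C L : ℝ} {F : ℝ → ℝ → ℝ}

/-- `U s` solves the initial value problem with value `0` and slope `s` at `a`. It comes from
Banach's fixed point theorem for the Volterra equation, and continuity in `s` from that of the fixed
point. -/
theorem exists_shooting (hab : a < b) (hF : Measurable (Function.uncurry F))
    (hC : ∀ t s, |F t s| ≤ C) (hL : ∀ t s s', |F t s - F t s'| ≤ L * |s - s'|) :
    ∃ U : ℝ → ℝ → ℝ, (∀ s, Continuous (U s)) ∧ (Continuous fun s => U s b) ∧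
      ∀ s, ∀ x ∈ Icc a b, U s x = s * (x - a) - ∫ t in a..x, (x - t) * F t (U s t) := by
  have hL0 : 0 ≤ L := by
    have := (abs_nonneg _).trans (hL 0 1 0)
    simpa using this
  have h0 : 0 < b - a := sub_pos.2 hab
  -- The exponential weight of Bielecki's norm: the contraction factor is at most `(b - a) * L / c ≤
  -- 1 / 2`. The fixed point is the weighted function `exp (-c (t - a)) u`, and `ext` removes the
  -- weight.
  set c : ℝ := 2 * L * (b - a) + 1 with hc
  have hc0 : 0 < c := by positivity
  let ext : C(Icc a b, ℝ) → ℝ → ℝ := fun z t => Real.exp (c * (t - a)) * IccExtend hab.le z t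
  have hext : ∀ z, Continuous (ext z) := fun z => by
    have := z.continuous.Icc_extend' (h := hab.le)
    simp only [ext]
    fun_prop
  have hm : ∀ z, Measurable fun t => F t (ext z t) := fun z =>
    hF.comp (measurable_id.prodMk (hext z).measurable)
  let T : ℝ → C(Icc a b, ℝ) → C(Icc a b, ℝ) := fun s z =>
    ⟨fun x => Real.exp (-(c * (x - a))) *
      (s * (x - a) - ∫ t in a..(x : ℝ), (x - t) * F t (ext z t)), by
      have := (continuous_volterra (hm z) (fun t => hC t _) a).comp
        (continuous_subtype_val (p := fun x => x ∈ Icc a b))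
      simp only [Function.comp_def] at this
      fun_prop⟩
  have hcontr : ∀ s, ContractingWith (1 / 2) (T s) := by
    intro s
    refine ⟨by rw [← NNReal.coe_lt_coe]; norm_num, LipschitzWith.of_dist_le_mul fun z w => ?_⟩
    rw [ContinuousMap.dist_le (by positivity)]
    intro x
    obtain ⟨x, hx1, hx2⟩ := x
    have hint : ∀ z, IntervalIntegrable (fun t => (x - t) * F t (ext z t)) volume a x := fun z =>
      (intervalIntegrable_of_bound (hm z) (fun t => hC t _) a x).continuousOn_mul (by fun_prop)
    have e : T s z ⟨x, hx1, hx2⟩ - T s w ⟨x, hx1, hx2⟩ = - (Real.exp (-(c * (x - a))) *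
        ∫ t in a..x, ((x - t) * F t (ext z t) - (x - t) * F t (ext w t))) := by
      rw [intervalIntegral.integral_sub (hint z) (hint w)]
      simp only [T, ContinuousMap.coe_mk]
      ring
    have hexp : ∫ t in a..x, Real.exp (c * (t - a)) = (Real.exp (c * (x - a)) - 1) / c := by
      rw [intervalIntegral.integral_eq_sub_of_hasDerivAt (f := fun t => Real.exp (c * (t - a)) / c)]
      · simp; ring
      · intro t _
        have : HasDerivAt (fun t => Real.exp (c * (t - a)) / c)
          (Real.exp (c * (t - a)) * (c * 1) / c) t :=
          ((((hasDerivAt_id t).sub_const a).const_mul c).exp).div_const c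
        rwa [mul_one, mul_div_cancel_right₀ _ hc0.ne'] at this
      · exact Continuous.intervalIntegrable (by fun_prop) _ _
    have hb : |∫ t in a..x, ((x - t) * F t (ext z t) - (x - t) * F t (ext w t))| ≤
        ∫ t in a..x, ((b - a) * L * dist z w) * Real.exp (c * (t - a)) := by
      rw [← Real.norm_eq_abs]
      refine intervalIntegral.norm_integral_le_of_norm_le hx1
        (Filter.Eventually.of_forall fun t ht => ?_)
        (Continuous.intervalIntegrable (by fun_prop) _ _)
      have h1 : |F t (ext z t) - F t (ext w t)| ≤ L * (Real.exp (c * (t - a)) * dist z w) := by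
        refine (hL t _ _).trans (mul_le_mul_of_nonneg_left ?_ hL0)
        simp only [ext]
        rw [← mul_sub, abs_mul, abs_of_pos (Real.exp_pos _)]
        exact mul_le_mul_of_nonneg_left (ContinuousMap.dist_apply_le_dist (f := z) (g := w)
          (projIcc a b hab.le t)) (Real.exp_pos _).le
      rw [← mul_sub, Real.norm_eq_abs, abs_mul, abs_of_nonneg (by linarith [ht.2])]
      calc (x - t) * |F t (ext z t) - F t (ext w t)|
          ≤ (b - a) * (L * (Real.exp (c * (t - a)) * dist z w)) :=
            mul_le_mul (by linarith [ht.1]) h1 (abs_nonneg _) h0.le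
        _ = _ := by ring
    rw [intervalIntegral.integral_const_mul, hexp] at hb
    rw [Real.dist_eq, e, abs_neg, abs_mul, abs_of_pos (Real.exp_pos _)]
    have hexp1 : Real.exp (-(c * (x - a))) * Real.exp (c * (x - a)) = 1 := by
      rw [← Real.exp_add]; simp
    calc _ ≤ Real.exp (-(c * (x - a))) *
          ((b - a) * L * dist z w * ((Real.exp (c * (x - a)) - 1) / c)) := by gcongr
      _ = (b - a) * L / c * dist z w * (Real.exp (-(c * (x - a))) * Real.exp (c * (x - a))
            - Real.exp (-(c * (x - a)))) := by ring
      _ ≤ (b - a) * L / c * dist z w * 1 := by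
          rw [hexp1]
          gcongr
          linarith [Real.exp_pos (-(c * (x - a)))]
      _ ≤ (1 / 2 : ℝ) * dist z w := by
          rw [mul_one]
          refine mul_le_mul_of_nonneg_right ?_ dist_nonneg
          rw [div_le_iff₀ hc0, hc]
          linarith
      _ = _ := by norm_num
  let Z : ℝ → C(Icc a b, ℝ) := fun s => ContractingWith.fixedPoint (T s) (hcontr s)
  have hZ : ∀ s, T s (Z s) = Z s := fun s => (hcontr s).fixedPoint_isFixedPt
  have hZc : Continuous Z := by
    -- The map moves by at most `(b - a) |s - s'|`; dividing by `1 - 1 / 2` bounds the move of its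
    -- fixed point.
    have : LipschitzWith (2 * (b - a)).toNNReal Z := by
      refine LipschitzWith.of_dist_le_mul fun s s' => ?_
      have key : ∀ z, dist (T s z) (T s' z) ≤ (b - a) * dist s s' := by
        intro z
        rw [ContinuousMap.dist_le (by positivity)]
        rintro ⟨x, hx1, hx2⟩
        have e : T s z ⟨x, hx1, hx2⟩ - T s' z ⟨x, hx1, hx2⟩ =
            Real.exp (-(c * (x - a))) * ((s - s') * (x - a)) := by
          simp only [T, ContinuousMap.coe_mk]
          ring
        rw [Real.dist_eq, Real.dist_eq, e, abs_mul, abs_mul, abs_of_pos (Real.exp_pos _),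
          abs_of_nonneg (show 0 ≤ x - a by linarith)]
        have h1 : Real.exp (-(c * (x - a))) ≤ 1 := by
          rw [Real.exp_le_one_iff]
          have := mul_nonneg hc0.le (show 0 ≤ x - a by linarith)
          linarith
        calc _ ≤ 1 * (|s - s'| * (b - a)) := by gcongr
          _ = _ := by ring
      have := (hcontr s).fixedPoint_lipschitz_in_map (hcontr s') key
      refine this.trans (le_of_eq ?_)
      rw [Real.coe_toNNReal _ (by positivity)]
      norm_num
      ring
    exact this.continuous
  refine ⟨fun s => ext (Z s), fun s => hext _, ?_, ?_⟩
  · have : Continuous fun s => Z s ⟨b, hab.le, le_rfl⟩ :=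
      (continuous_eval_const _).comp hZc
    have e : ∀ s, ext (Z s) b = Real.exp (c * (b - a)) * Z s ⟨b, hab.le, le_rfl⟩ := fun s => by
      simp only [ext]
      rw [IccExtend_right]
    simp only [e]
    fun_prop
  · intro s x hx
    have h1 : Z s ⟨x, hx⟩ = Real.exp (-(c * (x - a))) *
        (s * (x - a) - ∫ t in a..x, (x - t) * F t (ext (Z s) t)) := by
      conv_lhs => rw [← hZ s]
      rfl
    have h2 : ext (Z s) x = Real.exp (c * (x - a)) * Z s ⟨x, hx⟩ := by
      simp only [ext]
      rw [IccExtend_of_mem _ _ hx]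
    change ext (Z s) x = _
    rw [h2, h1, ← mul_assoc, ← Real.exp_add]
    simp

/-- The Dirichlet problem with bounded, globally Lipschitz right-hand side is solvable. -/
theorem exists_eq_greenPot (hab : a < b) (hF : Measurable (Function.uncurry F))
    (hC : ∀ t s, |F t s| ≤ C) (hL : ∀ t s s', |F t s - F t s'| ≤ L * |s - s'|) :
    ∃ u : ℝ → ℝ, Continuous u ∧ ∀ x ∈ Icc a b, u x = greenPot a b (fun t => F t (u t)) x := by
  obtain ⟨U, hUc, hUb, hU⟩ := exists_shooting hab hF hC hL
  have h0 : 0 < b - a := sub_pos.2 hab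
  have hm : ∀ s, Measurable fun t => F t (U s t) := fun s =>
    hF.comp (measurable_id.prodMk (hUc s).measurable)
  have hi := fun s => intervalIntegrable_of_bound (hm s) (fun t => hC t _)
  have hb : ∀ s, |∫ t in a..b, (b - t) * F t (U s t)| ≤ (b - a) * C * (b - a) := by
    intro s
    have := intervalIntegral.norm_integral_le_of_norm_le_const (a := a) (b := b)
      (C := (b - a) * C) (f := fun t => (b - t) * F t (U s t)) (fun t ht => by
        rw [uIoc_of_le hab.le] at ht
        rw [Real.norm_eq_abs, abs_mul, abs_of_nonneg (by linarith [ht.2])]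
        exact mul_le_mul (by linarith [ht.1]) (hC _ _) (abs_nonneg _) h0.le)
    rwa [abs_of_pos h0] at this
  -- At `s = ± C (b - a)` the linear term `s (b - a)` matches the bound on the integral term, so the
  -- endpoint value has the sign of `s` (or is zero) and the intermediate value theorem applies.
  obtain ⟨s, hs⟩ : ∃ s, U s b = 0 := by
    refine mem_range_of_exists_le_of_exists_ge hUb ⟨-(C * (b - a)), ?_⟩ ⟨C * (b - a), ?_⟩
    · rw [hU _ b ⟨hab.le, le_rfl⟩]
      linarith [(abs_le.1 (hb (-(C * (b - a))))).1]
    · rw [hU _ b ⟨hab.le, le_rfl⟩]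
      linarith [(abs_le.1 (hb (C * (b - a)))).2]
  refine ⟨U s, hUc s, fun x hx => ?_⟩
  set h := fun t => F t (U s t)
  have hs' : s * (b - a) = ∫ t in a..b, (b - t) * h t := by
    have := hU s b ⟨hab.le, le_rfl⟩
    rw [hs] at this
    linarith
  have e : greenPot a b h x = (x - a) / (b - a) * (∫ t in a..b, (b - t) * h t) -
      ∫ t in a..b, max (x - t) 0 * h t := by
    rw [← intervalIntegral.integral_const_mul, ← intervalIntegral.integral_sub
      (((hi s a b).continuousOn_mul (by fun_prop)).const_mul _)
      ((hi s a b).continuousOn_mul (by fun_prop))]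
    refine intervalIntegral.integral_congr fun t _ => ?_
    simp only [green]
    ring
  rw [e, ← hs', integral_max_sub_mul (hi s a b) hx, hU s x hx]
  field_simp

end shooting

/-! ### The truncated singular nonlinearity -/

/-- The distance to the boundary of `(a, b)`, extended by zero. -/
noncomputable def wt (a b t : ℝ) : ℝ := max 0 (min (t - a) (b - t))

theorem continuous_wt (a b : ℝ) : Continuous (wt a b) := by
  unfold wt; fun_prop

theorem wt_nonneg (a b t : ℝ) : 0 ≤ wt a b t := le_max_left _ _

theorem wt_eq {a b t : ℝ} (ht : t ∈ Icc a b) : wt a b t = min (t - a) (b - t) :=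
  max_eq_right (le_min (by linarith [ht.1]) (by linarith [ht.2]))

theorem wt_pos {a b t : ℝ} (ht : t ∈ Ioo a b) : 0 < wt a b t :=
  lt_max_of_lt_right (lt_min (by linarith [ht.1]) (by linarith [ht.2]))

theorem wt_le {a b : ℝ} (hab : a ≤ b) (t : ℝ) : wt a b t ≤ b - a := by
  refine max_le (by linarith) ?_
  rcases le_total t b with h | h
  · exact (min_le_left _ _).trans (by linarith)
  · exact (min_le_right _ _).trans (by linarith)

theorem bdist_eq_wt {a b t : ℝ} (hab : a < b) (ht : t ∈ Icc a b) : bdist a b t = wt a b t := by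
  have h1 : ({a, b} : Set ℝ).Nonempty := ⟨a, by simp⟩
  rw [bdist, frontier_Ioo hab, wt_eq ht]
  apply le_antisymm
  · refine le_min ?_ ?_
    · refine (Metric.infDist_le_dist_of_mem (show a ∈ ({a, b} : Set ℝ) by simp)).trans ?_
      rw [Real.dist_eq, abs_of_nonneg (by linarith [ht.1])]
    · refine (Metric.infDist_le_dist_of_mem (show b ∈ ({a, b} : Set ℝ) by simp)).trans ?_
      rw [Real.dist_eq, abs_of_nonpos (by linarith [ht.2])]
      linarith
  · rw [Metric.le_infDist h1]
    intro y hy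
    rcases hy with rfl | rfl
    · rw [Real.dist_eq, abs_of_nonneg (by linarith [ht.1])]
      exact min_le_left _ _
    · rw [Real.dist_eq, abs_of_nonpos (by linarith [ht.2])]
      exact (min_le_right _ _).trans (by linarith)

theorem abs_rpow_neg_sub_rpow_neg_le {β m x y : ℝ} (hβ : 0 < β) (hm : 0 < m) (hx : m ≤ x)
    (hy : m ≤ y) : |x ^ (-β) - y ^ (-β)| ≤ β * m ^ (-β - 1) * |x - y| := by
  have := Convex.norm_image_sub_le_of_norm_hasDerivWithin_le (f := fun x : ℝ => x ^ (-β))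
    (f' := fun x => -β * x ^ (-β - 1)) (s := Ici m) (x := y) (y := x) (C := β * m ^ (-β - 1))
    (fun z hz => (Real.hasDerivAt_rpow_const
      (Or.inl (hm.trans_le hz).ne')).hasDerivWithinAt)
    (fun z hz => by
      have hz0 : 0 < z := hm.trans_le hz
      rw [Real.norm_eq_abs, abs_mul, abs_neg, abs_of_pos hβ,
        abs_of_pos (Real.rpow_pos_of_pos hz0 _)]
      exact mul_le_mul_of_nonneg_left (Real.rpow_le_rpow_of_nonpos hm hz (by linarith)) hβ.le)
    (convex_Ici m) hy hx
  simpa only [Real.norm_eq_abs] using this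

/-- The nonlinearity `k s^(-β)`, with the weight `k` cut off near the boundary and
`s` cut off from below by `κ δ`. -/
noncomputable def cutTerm (a b : ℝ) (k : ℝ → ℝ) (β κ n t s : ℝ) : ℝ :=
  min (k t) (n * wt a b t ^ (β + 1)) * max s (κ * wt a b t) ^ (-β)

section cutTerm

variable {a b β κ n : ℝ} {k : ℝ → ℝ}

theorem cutTerm_nonneg (hk : ∀ t, 0 ≤ k t) (hκ : 0 < κ) (hn : 0 ≤ n) (t s : ℝ) :
    0 ≤ cutTerm a b k β κ n t s :=
  mul_nonneg (le_min (hk t) (mul_nonneg hn (Real.rpow_nonneg (wt_nonneg _ _ _) _)))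
    (Real.rpow_nonneg (le_max_of_le_right (mul_nonneg hκ.le (wt_nonneg _ _ _))) _)

theorem cutTerm_eq_zero (hk : ∀ t, 0 ≤ k t) (hβ : 0 < β) {t : ℝ} (ht : wt a b t = 0) (s : ℝ) :
    cutTerm a b k β κ n t s = 0 := by
  rw [cutTerm, ht, Real.zero_rpow (by linarith), mul_zero, min_eq_right (hk t), zero_mul]

theorem measurable_cutTerm (hk : Measurable k) :
    Measurable (Function.uncurry (cutTerm a b k β κ n)) := by
  have := (continuous_wt a b).measurable
  unfold cutTerm Function.uncurry
  fun_prop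

theorem cutTerm_le (hab : a < b) (hk : ∀ t, 0 ≤ k t) (hβ : 0 < β) (hκ : 0 < κ) (hn : 0 ≤ n)
    (t s : ℝ) : cutTerm a b k β κ n t s ≤ n * κ ^ (-β) * (b - a) := by
  have h0 : 0 < b - a := sub_pos.2 hab
  rcases (wt_nonneg a b t).eq_or_lt with h | h
  · rw [cutTerm_eq_zero hk hβ h.symm]
    positivity
  · have h1 : max s (κ * wt a b t) ^ (-β) ≤ (κ * wt a b t) ^ (-β) :=
      Real.rpow_le_rpow_of_nonpos (by positivity) (le_max_right _ _) (by linarith)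
    calc cutTerm a b k β κ n t s
        ≤ (n * wt a b t ^ (β + 1)) * (κ * wt a b t) ^ (-β) :=
          mul_le_mul (min_le_right _ _) h1
            (Real.rpow_nonneg (le_max_of_le_right (by positivity)) _) (by positivity)
      _ = n * κ ^ (-β) * wt a b t := by
          rw [Real.mul_rpow hκ.le h.le]
          have : wt a b t ^ (β + 1) * wt a b t ^ (-β) = wt a b t := by
            rw [← Real.rpow_add h]; simp
          linear_combination n * κ ^ (-β) * this
      _ ≤ n * κ ^ (-β) * (b - a) := by
          gcongr
          exact wt_le hab.le t

/-- This explains the exponent `β + 1` in the cut-off weight: the derivative of `s^(-β)` at height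
`κ δ` is of order `δ^(-β - 1)`, which the weight cancels exactly. -/
theorem abs_cutTerm_sub_le (hk : ∀ t, 0 ≤ k t) (hβ : 0 < β) (hκ : 0 < κ)
    (hn : 0 ≤ n) (t s s' : ℝ) :
    |cutTerm a b k β κ n t s - cutTerm a b k β κ n t s'| ≤
      n * β * κ ^ (-β - 1) * |s - s'| := by
  rcases (wt_nonneg a b t).eq_or_lt with h | h
  · rw [cutTerm_eq_zero hk hβ h.symm, cutTerm_eq_zero hk hβ h.symm, sub_zero, abs_zero]
    positivity
  · have h1 := abs_rpow_neg_sub_rpow_neg_le hβ (mul_pos hκ h) (le_max_right s _)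
      (le_max_right s' _)
    have h2 : |max s (κ * wt a b t) - max s' (κ * wt a b t)| ≤ |s - s'| :=
      abs_max_sub_max_le_abs s s' _
    have h3 : 0 ≤ min (k t) (n * wt a b t ^ (β + 1)) := le_min (hk t) (by positivity)
    rw [cutTerm, cutTerm, ← mul_sub, abs_mul, abs_of_nonneg h3]
    calc _ ≤ (n * wt a b t ^ (β + 1)) * (β * (κ * wt a b t) ^ (-β - 1) * |s - s'|) := by
          refine mul_le_mul (min_le_right _ _) (h1.trans ?_) (abs_nonneg _) (by positivity)
          gcongr
      _ = n * β * κ ^ (-β - 1) * |s - s'| := by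
          rw [Real.mul_rpow hκ.le h.le]
          have : wt a b t ^ (β + 1) * wt a b t ^ (-β - 1) = 1 := by
            rw [← Real.rpow_add h]; simp
          linear_combination n * β * κ ^ (-β - 1) * |s - s'| * this

/-- Free of `n`, this bound supplies the majorant for the passage to the limit. -/
theorem cutTerm_le_mul_wt (hk : ∀ t, 0 ≤ k t) (hβ : 0 < β) (hκ : 0 < κ) {t : ℝ}
    (ht : t ∈ Ioo a b) (s : ℝ) :
    cutTerm a b k β κ n t s ≤ κ ^ (-β) * (k t * wt a b t ^ (-β)) := by
  have h := wt_pos ht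
  have h1 : max s (κ * wt a b t) ^ (-β) ≤ (κ * wt a b t) ^ (-β) :=
    Real.rpow_le_rpow_of_nonpos (by positivity) (le_max_right _ _) (by linarith)
  calc cutTerm a b k β κ n t s ≤ k t * (κ * wt a b t) ^ (-β) :=
        mul_le_mul (min_le_left _ _) h1
          (Real.rpow_nonneg (le_max_of_le_right (by positivity)) _) (hk t)
    _ = _ := by
        rw [Real.mul_rpow hκ.le h.le]; ring

end cutTerm

/-! ### Green potentials compared with the distance to the boundary -/

section greenPotBounds

variable {a b : ℝ} {h : ℝ → ℝ}

theorem greenPot_le (hab : a < b) (hh : IntervalIntegrable h volume a b)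
    (h0 : ∀ t ∈ Icc a b, 0 ≤ h t) {x : ℝ} (hx : x ∈ Icc a b) :
    greenPot a b h x ≤ wt a b x * ∫ t in a..b, h t := by
  rw [← intervalIntegral.integral_const_mul, wt_eq hx]
  exact intervalIntegral.integral_mono_on hab.le (intervalIntegrable_green_mul hh x)
    (hh.const_mul _) fun t ht =>
      mul_le_mul_of_nonneg_right (green_le_min hab hx ht) (h0 t ht)

theorem greenPot_nonneg (hab : a < b)
    (h0 : ∀ t ∈ Icc a b, 0 ≤ h t) {x : ℝ} (hx : x ∈ Icc a b) :
    0 ≤ greenPot a b h x :=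
  intervalIntegral.integral_nonneg hab.le fun t ht =>
    mul_nonneg (green_nonneg hab hx ht) (h0 t ht)

theorem le_greenPot (hab : a < b) (hh : IntervalIntegrable h volume a b)
    (h0 : ∀ t ∈ Icc a b, 0 ≤ h t) {x : ℝ} (hx : x ∈ Icc a b) :
    (∫ t in a..b, h t * wt a b t) / (b - a) * wt a b x ≤ greenPot a b h x := by
  have e : (∫ t in a..b, h t * wt a b t) / (b - a) * wt a b x =
      ∫ t in a..b, (wt a b x * wt a b t / (b - a)) * h t := by
    rw [div_mul_eq_mul_div, mul_comm, ← intervalIntegral.integral_const_mul,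
      ← intervalIntegral.integral_div]
    refine intervalIntegral.integral_congr fun t _ => ?_
    ring
  have := continuous_wt a b
  rw [e]
  refine intervalIntegral.integral_mono_on hab.le (hh.continuousOn_mul (by fun_prop))
    (intervalIntegrable_green_mul hh x) fun t ht =>
      mul_le_mul_of_nonneg_right ?_ (h0 t ht)
  rw [wt_eq hx, wt_eq ht]
  exact min_mul_min_le_green hab hx ht

theorem greenPot_linear {h₁ h₂ : ℝ → ℝ} (hh₁ : IntervalIntegrable h₁ volume a b)
    (hh₂ : IntervalIntegrable h₂ volume a b) (p q x : ℝ) :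
    greenPot a b (fun t => p * h₁ t - q * h₂ t) x =
      p * greenPot a b h₁ x - q * greenPot a b h₂ x := by
  unfold greenPot
  rw [← intervalIntegral.integral_const_mul, ← intervalIntegral.integral_const_mul,
    ← intervalIntegral.integral_sub ((intervalIntegrable_green_mul hh₁ x).const_mul _)
      ((intervalIntegrable_green_mul hh₂ x).const_mul _)]
  refine intervalIntegral.integral_congr fun t _ => ?_
  ring

end greenPotBounds

theorem GreenRep.congr {c d : ℝ} {h u v : ℝ → ℝ} (H : GreenRep c d h u) (hcd : c ≤ d)
    (huv : ∀ x ∈ Icc c d, v x = u x) : GreenRep c d h v := by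
  intro x hx
  rw [huv x hx, huv c ⟨le_rfl, hcd⟩, huv d ⟨hcd, le_rfl⟩]
  exact H x hx

/-! ### Subsolution and approximating problems -/

section approx

variable {a b α γ : ℝ} {K M : ℝ → ℝ}

/-- A subsolution comparable with the distance to the boundary, in terms of its Laplacian. -/
theorem exists_subsolution (hab : a < b) (hK : Measurable K)
    (hK0 : ∀ t, 0 ≤ K t) (hM0 : ∀ t, 0 ≤ M t) (hα : 0 < α)
    (hKne : ¬ K =ᵐ[vol a b] 0)
    (hMi : IntervalIntegrable (fun t => M t * wt a b t ^ (-γ)) volume a b) :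
    ∃ κ > 0, ∃ lam₀ > 0, ∃ hv : ℝ → ℝ, IntervalIntegrable hv volume a b ∧
      (∀ x ∈ Icc a b, κ * wt a b x ≤ greenPot a b hv x ∧ greenPot a b hv x ≤ 1) ∧
      ∀ t, hv t ≤ min (K t) (wt a b t ^ (α + 1)) -
        lam₀ * κ ^ (-γ) * (M t * wt a b t ^ (-γ)) := by
  have hba : 0 < b - a := sub_pos.2 hab
  have hwc := continuous_wt a b
  have hwm := hwc.measurable
  -- The cut-off weight for `n = 1`; it lies below those for all `n ≥ 1`, so one subsolution serves
  -- every approximation.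
  set K₁ : ℝ → ℝ := fun t => min (K t) (wt a b t ^ (α + 1)) with hK₁
  have hK₁m : Measurable K₁ := by fun_prop
  have hK₁0 : ∀ t, 0 ≤ K₁ t := fun t =>
    le_min (hK0 t) (Real.rpow_nonneg (wt_nonneg _ _ _) _)
  have hK₁b : ∀ t, |K₁ t| ≤ (b - a) ^ (α + 1) := fun t => by
    rw [abs_of_nonneg (hK₁0 t)]
    exact (min_le_right _ _).trans
      (Real.rpow_le_rpow (wt_nonneg _ _ _) (wt_le hab.le t) (by linarith))
  have hK₁i := intervalIntegrable_of_bound hK₁m hK₁b a b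
  have hprod : IntervalIntegrable (fun t => K₁ t * wt a b t) volume a b :=
    hK₁i.mul_continuousOn hwc.continuousOn
  have hpos : 0 < ∫ t in a..b, K₁ t * wt a b t := by
    have hnn : 0 ≤ ∫ t in a..b, K₁ t * wt a b t :=
      intervalIntegral.integral_nonneg hab.le fun t _ => mul_nonneg (hK₁0 t) (wt_nonneg _ _ _)
    refine lt_of_le_of_ne hnn fun h => hKne ?_
    rw [intervalIntegral.integral_of_le hab.le, integral_Ioc_eq_integral_Ioo, eq_comm,
      integral_eq_zero_iff_of_nonneg (fun t => mul_nonneg (hK₁0 t) (wt_nonneg _ _ _))] at h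
    · rw [vol]
      filter_upwards [h, ae_restrict_mem measurableSet_Ioo] with t ht htm
      have hw := wt_pos htm
      simp only [Pi.zero_apply, mul_eq_zero, hw.ne', or_false] at ht
      have hw' : 0 < wt a b t ^ (α + 1) := Real.rpow_pos_of_pos hw _
      by_contra hne
      have : 0 < K₁ t := lt_min (lt_of_le_of_ne (hK0 t) (Ne.symm hne)) hw'
      linarith
    · exact ((intervalIntegrable_iff_integrableOn_Ioo_of_le hab.le).1 hprod)
  set N : ℝ → ℝ := fun t => M t * wt a b t ^ (-γ) with hN
  have hN0 : ∀ t, 0 ≤ N t := fun t => mul_nonneg (hM0 t) (Real.rpow_nonneg (wt_nonneg _ _ _) _)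
  set c₁ := (∫ t in a..b, K₁ t * wt a b t) / (b - a)
  have hc₁ : 0 < c₁ := div_pos hpos hba
  set C₂ := ∫ t in a..b, N t
  have hC₂ : 0 ≤ C₂ := intervalIntegral.integral_nonneg hab.le fun t _ => hN0 t
  set D := ∫ t in a..b, K₁ t
  have hD : 0 ≤ D := intervalIntegral.integral_nonneg hab.le fun t _ => hK₁0 t
  -- With this `σ` the negative part consumes at most half of the lower bound `c₁ δ`; the factor `ε`
  -- below then brings the subsolution under `1`.
  set σ := c₁ / (2 * (C₂ + 1))
  have hσ : 0 < σ := by positivity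
  have hσC : σ * C₂ ≤ c₁ / 2 := by
    simp only [σ]
    rw [div_mul_eq_mul_div, div_le_div_iff₀ (by positivity) (by positivity)]
    nlinarith
  set ε := 1 / (1 + (b - a) * D)
  have hε : 0 < ε := by positivity
  have hε1 : ε ≤ 1 := by
    simp only [ε]
    rw [div_le_one (by positivity)]
    linarith [mul_nonneg hba.le hD]
  have hεD : ε * ((b - a) * D) ≤ 1 := by
    simp only [ε]
    rw [div_mul_eq_mul_div, div_le_one (by positivity)]
    linarith
  set κ := ε * (c₁ / 2)
  have hκ : 0 < κ := by positivity
  -- The threshold for `lam` is chosen so that `lam₀ κ^(-γ) = ε σ`.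
  refine ⟨κ, hκ, ε * σ * κ ^ γ, by positivity, fun t => ε * K₁ t - ε * σ * N t,
    (hK₁i.const_mul _).sub (hMi.const_mul _), fun x hx => ?_, fun t => ?_⟩
  · rw [greenPot_linear hK₁i hMi]
    have hwx := wt_nonneg a b x
    have h1 := le_greenPot hab hK₁i (fun t _ => hK₁0 t) hx
    have h2 := greenPot_le hab hK₁i (fun t _ => hK₁0 t) hx
    have h3 := greenPot_le hab hMi (fun t _ => hN0 t) hx
    have h4 := greenPot_nonneg hab (fun t _ => hN0 t) hx
    constructor
    · have h5 : σ * greenPot a b N x ≤ wt a b x * (c₁ / 2) := by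
        calc _ ≤ σ * (wt a b x * C₂) := by gcongr
          _ = wt a b x * (σ * C₂) := by ring
          _ ≤ _ := by gcongr
      have h6 : c₁ / 2 * wt a b x ≤ greenPot a b K₁ x - σ * greenPot a b N x := by
        linarith
      calc κ * wt a b x = ε * (c₁ / 2 * wt a b x) := by ring
        _ ≤ ε * (greenPot a b K₁ x - σ * greenPot a b N x) := by gcongr
        _ = _ := by ring
    · have h5 : greenPot a b K₁ x ≤ (b - a) * D :=
        h2.trans (mul_le_mul_of_nonneg_right (wt_le hab.le x) hD)
      have h6 : 0 ≤ ε * σ * greenPot a b N x := by positivity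
      have h7 : ε * greenPot a b K₁ x ≤ ε * ((b - a) * D) := by gcongr
      linarith
  · have e : ε * σ * κ ^ γ * κ ^ (-γ) = ε * σ := by
      rw [mul_assoc (ε * σ), ← Real.rpow_add hκ]; simp
    rw [e]
    have : ε * K₁ t ≤ 1 * K₁ t := mul_le_mul_of_nonneg_right hε1 (hK₁0 t)
    linarith

/-- The solutions of the approximating problems, with bounds that do not depend on `n`. -/
theorem exists_approx (hab : a < b) (hK : Measurable K) (hM : Measurable M)
    (hK0 : ∀ t, 0 ≤ K t) (hM0 : ∀ t, 0 ≤ M t) (hα : 0 < α) (hγ : 0 < γ)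
    (hKi : IntervalIntegrable K volume a b)
    {κ lam₀ : ℝ} (hκ : 0 < κ) {hv : ℝ → ℝ} (hvi : IntervalIntegrable hv volume a b)
    (hv1 : ∀ x ∈ Icc a b, κ * wt a b x ≤ greenPot a b hv x ∧ greenPot a b hv x ≤ 1)
    (hv2 : ∀ t, hv t ≤ min (K t) (wt a b t ^ (α + 1)) -
        lam₀ * κ ^ (-γ) * (M t * wt a b t ^ (-γ)))
    {lam : ℝ} (hlam : 0 < lam) (hlam₀ : lam ≤ lam₀) {n : ℝ} (hn : 1 ≤ n) :
    ∃ u : ℝ → ℝ, Continuous u ∧ (∀ x ∈ Icc a b, κ * wt a b x ≤ u x) ∧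
      (∀ x ∈ Icc a b, ∀ η > 0, u x ≤ η + η ^ (-α) * greenPot a b K x) ∧
      u a = 0 ∧ u b = 0 ∧
      IntervalIntegrable (fun t => cutTerm a b K α κ n t (u t) -
        lam * cutTerm a b M γ κ n t (u t)) volume a b ∧
      GreenRep a b (fun t => cutTerm a b K α κ n t (u t) -
        lam * cutTerm a b M γ κ n t (u t)) u := by
  have hn0 : 0 ≤ n := by linarith
  have hFm : Measurable (Function.uncurry fun t s =>
      cutTerm a b K α κ n t s - lam * cutTerm a b M γ κ n t s) :=
    (measurable_cutTerm hK).sub ((measurable_cutTerm hM).const_mul lam)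
  have hFC : ∀ t s, |cutTerm a b K α κ n t s - lam * cutTerm a b M γ κ n t s| ≤
      n * κ ^ (-α) * (b - a) + lam * (n * κ ^ (-γ) * (b - a)) := fun t s => by
    refine (abs_sub _ _).trans (add_le_add ?_ ?_)
    · rw [abs_of_nonneg (cutTerm_nonneg hK0 hκ hn0 t s)]
      exact cutTerm_le hab hK0 hα hκ hn0 t s
    · rw [abs_mul, abs_of_pos hlam, abs_of_nonneg (cutTerm_nonneg hM0 hκ hn0 t s)]
      exact mul_le_mul_of_nonneg_left (cutTerm_le hab hM0 hγ hκ hn0 t s) hlam.le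
  have hFL : ∀ t s s', |(cutTerm a b K α κ n t s - lam * cutTerm a b M γ κ n t s) -
      (cutTerm a b K α κ n t s' - lam * cutTerm a b M γ κ n t s')| ≤
      (n * α * κ ^ (-α - 1) + lam * (n * γ * κ ^ (-γ - 1))) * |s - s'| := fun t s s' => by
    have h1 := abs_cutTerm_sub_le (a := a) (b := b) hK0 hα hκ hn0 t s s'
    have h2 := mul_le_mul_of_nonneg_left
      (abs_cutTerm_sub_le (a := a) (b := b) hM0 hγ hκ hn0 t s s') hlam.le
    calc _ = |(cutTerm a b K α κ n t s - cutTerm a b K α κ n t s') -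
          lam * (cutTerm a b M γ κ n t s - cutTerm a b M γ κ n t s')| := by congr 1; ring
      _ ≤ n * α * κ ^ (-α - 1) * |s - s'| + lam * (n * γ * κ ^ (-γ - 1) * |s - s'|) :=
          (abs_sub _ _).trans (add_le_add h1 (by rwa [abs_mul, abs_of_pos hlam]))
      _ = _ := by ring
  obtain ⟨u, huc, hu⟩ := exists_eq_greenPot hab hFm hFC hFL
  set h : ℝ → ℝ := fun t => cutTerm a b K α κ n t (u t) - lam * cutTerm a b M γ κ n t (u t)
    with hh
  have hhm : Measurable h := hFm.comp (measurable_id.prodMk huc.measurable)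
  have hhi : IntervalIntegrable h volume a b :=
    intervalIntegrable_of_bound hhm (fun t => hFC t _) a b
  have hrep : GreenRep a b h u := (greenRep_greenPot hab h).congr hab.le hu
  have hua : u a = 0 := by rw [hu a ⟨le_rfl, hab.le⟩, greenPot_left hab]
  have hub : u b = 0 := by rw [hu b ⟨hab.le, le_rfl⟩, greenPot_right hab]
  -- Comparison with the subsolution `v`. Where `u < v`, the cut-off height `max u (κ δ)` is at most
  -- `v ≤ 1`, so its power `-α` is at least `1` and the `K` term dominates `K₁`; the cut at `κ δ`
  -- bounds the `M` term. Hence `-(v - u)'' ≤ 0` there.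
  have hlow : ∀ x ∈ Icc a b, greenPot a b hv x - u x ≤ 0 := by
    refine ((greenRep_greenPot hab hv).sub hrep hvi hhi).le_of_nonpos hab (hvi.sub hhi)
      (by rw [hua, greenPot_left hab]; simp) (by rw [hub, greenPot_right hab]; simp) ?_
    intro t ht hlt
    have hw := wt_pos ht
    obtain ⟨hV1, hV2⟩ := hv1 t (Ioo_subset_Icc_self ht)
    set m := max (u t) (κ * wt a b t) with hm
    have hm0 : 0 < m := lt_max_of_lt_right (by positivity)
    have hm1 : m ≤ 1 := max_le (by linarith) (by linarith)
    have hP : min (K t) (wt a b t ^ (α + 1)) ≤ cutTerm a b K α κ n t (u t) := by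
      have h1 : 1 ≤ m ^ (-α) := by
        have := Real.rpow_le_rpow_of_nonpos hm0 hm1 (show -α ≤ 0 by linarith)
        simpa using this
      have h2 : min (K t) (wt a b t ^ (α + 1)) ≤ min (K t) (n * wt a b t ^ (α + 1)) :=
        min_le_min le_rfl (le_mul_of_one_le_left (by positivity) hn)
      have h3 : 0 ≤ min (K t) (n * wt a b t ^ (α + 1)) := le_min (hK0 t) (by positivity)
      exact h2.trans (le_mul_of_one_le_right h3 h1)
    have hQ : lam * cutTerm a b M γ κ n t (u t) ≤ lam₀ * κ ^ (-γ) * (M t * wt a b t ^ (-γ)) := by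
      rw [mul_assoc]
      exact mul_le_mul hlam₀ (cutTerm_le_mul_wt hM0 hγ hκ ht _) (cutTerm_nonneg hM0 hκ hn0 _ _)
        (hlam.le.trans hlam₀)
    have := hv2 t
    simp only [hh]
    linarith
  refine ⟨u, huc, fun x hx => (hv1 x hx).1.trans (by linarith [hlow x hx]), ?_, hua, hub, hhi,
    hrep⟩
  intro x hx η hη
  have hψ : GreenRep a b (fun t => η ^ (-α) * K t) (fun x => η ^ (-α) * greenPot a b K x) := by
    intro y hy
    have := greenRep_greenPot hab K y hy
    simp only [greenPot_left hab, greenPot_right hab, mul_zero, add_zero, zero_div,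
      zero_add] at this ⊢
    rw [this, ← intervalIntegral.integral_const_mul]
    refine intervalIntegral.integral_congr fun t _ => ?_
    ring
  -- The maximum principle at level `η` for `u - η^(-α) G K`: where this exceeds `η`, also `u > η`,
  -- so the `K` term is at most `η^(-α) K`, and the `M` term only lowers the right-hand side.
  have hup := (hrep.sub hψ hhi (hKi.const_mul _)).le_of_nonpos (η := η) hab
    (hhi.sub (hKi.const_mul _)) (by rw [hua, greenPot_left hab]; simp [hη.le])
    (by rw [hub, greenPot_right hab]; simp [hη.le]) ?_ x hx
  · linarith
  · intro t ht hlt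
    have hψ0 := greenPot_nonneg hab (fun s _ => hK0 s) (Ioo_subset_Icc_self ht)
    have hηp : 0 < η ^ (-α) := Real.rpow_pos_of_pos hη _
    have hut : η ≤ max (u t) (κ * wt a b t) :=
      le_max_of_le_left (by linarith [mul_nonneg hηp.le hψ0])
    have h1 : max (u t) (κ * wt a b t) ^ (-α) ≤ η ^ (-α) :=
      Real.rpow_le_rpow_of_nonpos hη hut (by linarith)
    have h2 : cutTerm a b K α κ n t (u t) ≤ K t * η ^ (-α) :=
      mul_le_mul (min_le_left _ _) h1 (Real.rpow_nonneg (hη.le.trans hut) _) (hK0 t)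
    have h3 := mul_nonneg hlam.le
      (cutTerm_nonneg (a := a) (b := b) (β := γ) hM0 hκ hn0 t (u t))
    simp only [hh]
    linarith

end approx

/-! ### Compactness and passage to the limit -/

open Filter Topology in
/-- A bounded and locally equi-Lipschitz sequence on an open interval has a pointwise convergent
subsequence. -/
theorem exists_subseq_tendsto {a b W : ℝ} {u : ℕ → ℝ → ℝ}
    (hW : ∀ n, ∀ x ∈ Ioo a b, |u n x| ≤ W)
    (hL : ∀ c d, a < c → c < d → d < b →
      ∃ C, ∀ n, ∀ x ∈ Icc c d, ∀ y ∈ Icc c d, |u n x - u n y| ≤ C * |x - y|) :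
    ∃ φ : ℕ → ℕ, StrictMono φ ∧ ∃ v : ℝ → ℝ, ∀ x ∈ Ioo a b,
      Tendsto (fun n => u (φ n) x) atTop (𝓝 (v x)) := by
  classical
  let w : ℕ → ℚ → ℝ := fun n q => if (q : ℝ) ∈ Ioo a b then u n q else 0
  have hcomp : IsCompact (univ.pi fun _ : ℚ => Icc (-|W|) |W|) :=
    isCompact_univ_pi fun _ => isCompact_Icc
  have hw : ∀ n, w n ∈ univ.pi fun _ : ℚ => Icc (-|W|) |W| := by
    intro n q _
    simp only [w]
    split_ifs with hq
    · exact abs_le.1 ((hW n q hq).trans (le_abs_self W))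
    · exact ⟨by simp, by simp⟩
  -- Tychonoff on the countably many rationals replaces a diagonal argument; the local Lipschitz
  -- bound then carries convergence from rational points to all points.
  obtain ⟨w₀, -, φ, hφ, hlim⟩ := hcomp.tendsto_subseq hw
  refine ⟨φ, hφ, ?_⟩
  have key : ∀ x ∈ Ioo a b, ∃ l, Tendsto (fun n => u (φ n) x) atTop (𝓝 l) := by
    intro x hx
    refine cauchySeq_tendsto_of_complete (Metric.cauchySeq_iff'.2 fun ε hε => ?_)
    obtain ⟨c, hac, hcx⟩ := exists_between hx.1
    obtain ⟨d, hxd, hdb⟩ := exists_between hx.2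
    obtain ⟨C, hC⟩ := hL c d hac (hcx.trans hxd) hdb
    have hpos : 0 < ε / (3 * (|C| + 1)) := by positivity
    obtain ⟨q, hq1, hq2⟩ := exists_rat_btwn
      (show x < min d (x + ε / (3 * (|C| + 1))) from lt_min hxd (by linarith))
    have hqd : (q : ℝ) < d := hq2.trans_le (min_le_left _ _)
    have hqx : (q : ℝ) - x < ε / (3 * (|C| + 1)) := by
      linarith [hq2.trans_le (min_le_right _ _)]
    have hqab : (q : ℝ) ∈ Ioo a b := ⟨by linarith, by linarith⟩
    have hqlim : Tendsto (fun n => u (φ n) q) atTop (𝓝 (w₀ q)) := by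
      have := (tendsto_pi_nhds.1 hlim) q
      simpa only [w, Function.comp_def, if_pos hqab] using this
    have hclose : ∀ n, |u (φ n) x - u (φ n) q| < ε / 3 := by
      intro n
      have h1 := hC (φ n) x ⟨hcx.le, hxd.le⟩ q ⟨by linarith, hqd.le⟩
      rw [abs_sub_comm x, abs_of_pos (show 0 < (q : ℝ) - x by linarith)] at h1
      calc _ ≤ C * (q - x) := h1
        _ ≤ (|C| + 1) * (q - x) := by
            refine mul_le_mul_of_nonneg_right ?_ (by linarith)
            linarith [le_abs_self C]
        _ < (|C| + 1) * (ε / (3 * (|C| + 1))) := by gcongr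
        _ = ε / 3 := by field_simp
    obtain ⟨N, hN⟩ := Metric.cauchySeq_iff'.1 hqlim.cauchySeq (ε / 3) (by positivity)
    refine ⟨N, fun n hn => ?_⟩
    have h2 := hN n hn
    have h3 := hclose n
    have h4 := hclose N
    rw [Real.dist_eq] at h2 ⊢
    rw [abs_lt] at *
    constructor <;> linarith [h2.1, h2.2, h3.1, h3.2, h4.1, h4.2]
  choose! v hv using key
  exact ⟨v, hv⟩

theorem intervalIntegrable_mul_wt_rpow {a b c d β : ℝ} {K : ℝ → ℝ}
    (hKi : IntervalIntegrable K volume a b) (hac : a < c) (hcd : c < d) (hdb : d < b) :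
    IntervalIntegrable (fun t => K t * wt a b t ^ β) volume c d := by
  have hsub : Icc c d ⊆ Ioo a b := fun t ht => ⟨hac.trans_le ht.1, ht.2.trans_lt hdb⟩
  refine (hKi.mono_set ?_).mul_continuousOn ?_
  · rw [uIcc_of_le hcd.le, uIcc_of_le (by linarith)]
    exact Icc_subset_Icc hac.le hdb.le
  · rw [uIcc_of_le hcd.le]
    exact (continuous_wt a b).continuousOn.rpow_const fun t ht => Or.inl (wt_pos (hsub ht)).ne'

open Filter Topology in
/-- Passing to the limit in the approximating problems. -/
theorem GreenRep.of_tendsto {c d : ℝ} {h : ℕ → ℝ → ℝ} {u : ℕ → ℝ → ℝ} {f v g : ℝ → ℝ}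
    (hcd : c < d) (H : ∀ n, GreenRep c d (h n) (u n))
    (hh : ∀ n, IntervalIntegrable (h n) volume c d) (hg : IntervalIntegrable g volume c d)
    (hhg : ∀ n, ∀ t ∈ Ioo c d, |h n t| ≤ g t)
    (hlim : ∀ t ∈ Ioo c d, Tendsto (fun n => h n t) atTop (𝓝 (f t)))
    (hu : ∀ x ∈ Icc c d, Tendsto (fun n => u n x) atTop (𝓝 (v x))) :
    IntervalIntegrable f volume c d ∧ GreenRep c d f v := by
  -- Bounds and convergence are available only on the open interval; the endpoint `d` is a null set.
  have hne : ∀ᵐ t : ℝ, t ∈ uIoc c d → t ∈ Ioo c d := by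
    have : ∀ᵐ t : ℝ, t ≠ d := by simp [ae_iff]
    filter_upwards [this] with t ht h
    rw [uIoc_of_le hcd.le] at h
    exact ⟨h.1, lt_of_le_of_ne h.2 ht⟩
  constructor
  · have hm : AEStronglyMeasurable f (volume.restrict (uIoc c d)) := by
      refine aestronglyMeasurable_of_tendsto_ae atTop (fun n => (hh n).def'.aestronglyMeasurable) ?_
      rw [ae_restrict_iff' measurableSet_uIoc]
      filter_upwards [hne] with t ht h using hlim t (ht h)
    refine hg.mono_fun' hm ?_
    rw [EventuallyLE, ae_restrict_iff' measurableSet_uIoc]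
    filter_upwards [hne] with t ht h
    exact le_of_tendsto (hlim t (ht h)).norm (Eventually.of_forall fun n => hhg n t (ht h))
  · intro x hx
    have h1 : Tendsto (fun n => ∫ t in c..d, green c d x t * h n t) atTop
        (𝓝 (∫ t in c..d, green c d x t * f t)) := by
      refine intervalIntegral.tendsto_integral_filter_of_dominated_convergence
        (fun t => (d - c) * g t) (Eventually.of_forall fun n =>
          (intervalIntegrable_green_mul (hh n) x).def'.aestronglyMeasurable)
        (Eventually.of_forall fun n => ?_) (hg.const_mul _) ?_
      · filter_upwards [hne] with t ht h
        rw [Real.norm_eq_abs, abs_mul]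
        exact mul_le_mul (abs_green_le hcd hx (Ioo_subset_Icc_self (ht h))) (hhg n t (ht h))
          (abs_nonneg _) (by linarith)
      · filter_upwards [hne] with t ht h using (hlim t (ht h)).const_mul _
    have h2 := (((hu c ⟨le_rfl, hcd.le⟩).const_mul (d - x)).add
      ((hu d ⟨hcd.le, le_rfl⟩).const_mul (x - c))).div_const (d - c)
    refine tendsto_nhds_unique (hu x hx) ((h2.add h1).congr fun n => ?_)
    exact (H n x hx).symm

open Filter Topology in
theorem tendsto_cutTerm {a b β κ : ℝ} {k : ℝ → ℝ} {t : ℝ} {s : ℕ → ℝ} {l : ℝ} {φ : ℕ → ℕ}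
    (hφ : StrictMono φ) (ht : t ∈ Ioo a b) (hκ : 0 < κ) (hs : Tendsto s atTop (𝓝 l))
    (hl : κ * wt a b t ≤ l) :
    Tendsto (fun n => cutTerm a b k β κ (φ n + 1) t (s n)) atTop (𝓝 (k t * l ^ (-β))) := by
  have hw := wt_pos ht
  unfold cutTerm
  refine Tendsto.mul ?_ ?_
  · have h1 : Tendsto (fun n => ((φ n : ℝ) + 1) * wt a b t ^ (β + 1)) atTop atTop :=
      ((tendsto_natCast_atTop_atTop.comp hφ.tendsto_atTop).atTop_add
        tendsto_const_nhds).atTop_mul_const (by positivity)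
    refine tendsto_const_nhds.congr' ?_
    filter_upwards [h1.eventually_ge_atTop (k t)] with n hn
    rw [min_eq_left hn]
  · have h2 : Tendsto (fun n => max (s n) (κ * wt a b t)) atTop (𝓝 (max l (κ * wt a b t))) :=
      hs.max tendsto_const_nhds
    rw [max_eq_left hl] at h2
    exact h2.rpow_const (Or.inl ((mul_pos hκ hw).trans_le hl).ne')

-- The integrability condition on `K δ^(-α)` over `(c, d)` lets one statement serve twice: it is
-- automatic on compact subintervals, which gives the equation, and on `(a, b)` itself it is the
-- extra hypothesis behind regularity up to the boundary.
open Filter Topology in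
theorem exists_greenRep_solution {a b α γ : ℝ} {K M : ℝ → ℝ} (hab : a < b) (hK : Measurable K)
    (hM : Measurable M) (hK0 : ∀ t, 0 ≤ K t) (hM0 : ∀ t, 0 ≤ M t) (hα : 0 < α) (hγ : 0 < γ)
    (hKne : ¬ K =ᵐ[vol a b] 0) (hKi : IntervalIntegrable K volume a b)
    (hMi : IntervalIntegrable (fun t => M t * wt a b t ^ (-γ)) volume a b) :
    ∃ κ > 0, ∃ lam₀ > 0, ∀ lam, 0 < lam → lam ≤ lam₀ → ∃ u : ℝ → ℝ,
      u a = 0 ∧ u b = 0 ∧ ContinuousOn u (Icc a b) ∧ (∀ x ∈ Icc a b, κ * wt a b x ≤ u x) ∧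
      ∀ c d, a ≤ c → c < d → d ≤ b →
        IntervalIntegrable (fun t => K t * wt a b t ^ (-α)) volume c d →
        IntervalIntegrable (fun t => K t * u t ^ (-α) - lam * M t * u t ^ (-γ)) volume c d ∧
        GreenRep c d (fun t => K t * u t ^ (-α) - lam * M t * u t ^ (-γ)) u := by
  obtain ⟨κ, hκ, lam₀, hlam₀, hv, hvi, hv1, hv2⟩ :=
    exists_subsolution hab hK hK0 hM0 hα hKne hMi
  refine ⟨κ, hκ, lam₀, hlam₀, fun lam hlam hle => ?_⟩
  choose u huc hlow hup hua hub hhi hrep using fun n : ℕ =>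
    exists_approx hab hK hM hK0 hM0 hα hγ hKi hκ hvi hv1 hv2 hlam hle
      (n := (n : ℝ) + 1) (by linarith [n.cast_nonneg (α := ℝ)])
  set ψ := greenPot a b K with hψ
  have hunn : ∀ n, ∀ x ∈ Icc a b, 0 ≤ u n x := fun n x hx =>
    (mul_nonneg hκ.le (wt_nonneg a b x)).trans (hlow n x hx)
  have hKI : 0 ≤ ∫ t in a..b, K t := intervalIntegral.integral_nonneg hab.le fun t _ => hK0 t
  set W := 1 + (b - a) * ∫ t in a..b, K t with hW
  have huW : ∀ n, ∀ x ∈ Icc a b, u n x ≤ W := fun n x hx => by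
    have h1 := hup n x hx 1 one_pos
    have h2 := greenPot_le hab hKi (fun t _ => hK0 t) hx
    have h3 := mul_le_mul_of_nonneg_right (wt_le hab.le x) hKI
    rw [Real.one_rpow, one_mul] at h1
    linarith
  set g : ℝ → ℝ := fun t => κ ^ (-α) * (K t * wt a b t ^ (-α)) +
    lam * (κ ^ (-γ) * (M t * wt a b t ^ (-γ))) with hgdef
  have hbound : ∀ n : ℕ, ∀ t ∈ Ioo a b, |cutTerm a b K α κ (n + 1) t (u n t) -
      lam * cutTerm a b M γ κ (n + 1) t (u n t)| ≤ g t := fun n t ht => by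
    have hn : (0 : ℝ) ≤ n + 1 := by positivity
    refine (abs_sub _ _).trans (add_le_add ?_ ?_)
    · rw [abs_of_nonneg (cutTerm_nonneg hK0 hκ hn _ _)]
      exact cutTerm_le_mul_wt hK0 hα hκ ht _
    · rw [abs_mul, abs_of_pos hlam, abs_of_nonneg (cutTerm_nonneg hM0 hκ hn _ _)]
      exact mul_le_mul_of_nonneg_left (cutTerm_le_mul_wt hM0 hγ hκ ht _) hlam.le
  have hmono : ∀ {c d : ℝ} {f : ℝ → ℝ}, a ≤ c → c < d → d ≤ b →
      IntervalIntegrable f volume a b → IntervalIntegrable f volume c d := by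
    intro c d f hac hcd hdb hf
    refine hf.mono_set ?_
    rw [uIcc_of_le hcd.le, uIcc_of_le hab.le]
    exact Icc_subset_Icc hac hdb
  have hgi : ∀ c d, a ≤ c → c < d → d ≤ b →
      IntervalIntegrable (fun t => K t * wt a b t ^ (-α)) volume c d →
      IntervalIntegrable g volume c d := fun c d hac hcd hdb hi =>
    (hi.const_mul _).add (((hmono hac hcd hdb hMi).const_mul _).const_mul _)
  obtain ⟨φ, hφ, v, hv⟩ := exists_subseq_tendsto (a := a) (b := b) (u := u) (W := W)
    (fun n x hx => by
      rw [abs_of_nonneg (hunn n x (Ioo_subset_Icc_self hx))]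
      exact huW n x (Ioo_subset_Icc_self hx))
    (fun c d hac hcd hdb => by
      refine ⟨W / (d - c) + ∫ t in c..d, g t, fun n x hx y hy => ?_⟩
      have h1 := ((hrep n).mono hac.le hcd hdb.le (hhi n)).abs_sub_le hcd
        (hmono hac.le hcd hdb.le (hhi n))
        (hgi c d hac.le hcd hdb.le (intervalIntegrable_mul_wt_rpow hKi hac hcd hdb))
        (fun t ht => hbound n t ⟨hac.trans ht.1, ht.2.trans hdb⟩) hx hy
      refine h1.trans (mul_le_mul_of_nonneg_right ?_ (abs_nonneg _))
      have hc : c ∈ Icc a b := ⟨by linarith, by linarith⟩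
      have hd : d ∈ Icc a b := ⟨by linarith, by linarith⟩
      have h2 : |u n d - u n c| ≤ W := by
        rw [abs_le]
        constructor <;> linarith [hunn n c hc, hunn n d hd, huW n c hc, huW n d hd]
      gcongr)
  set w : ℝ → ℝ := fun x => if x ∈ Ioo a b then v x else 0 with hwdef
  have hwa : w a = 0 := by simp [hwdef]
  have hwb : w b = 0 := by simp [hwdef]
  have hlim : ∀ x ∈ Icc a b, Tendsto (fun n => u (φ n) x) atTop (𝓝 (w x)) := by
    intro x hx
    rcases hx.1.eq_or_lt with rfl | h1
    · simp only [hwa, hua, tendsto_const_nhds]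
    rcases hx.2.eq_or_lt with rfl | h2
    · simp only [hwb, hub, tendsto_const_nhds]
    · simp only [hwdef, if_pos (show x ∈ Ioo a b from ⟨h1, h2⟩)]
      exact hv x ⟨h1, h2⟩
  have hwlow : ∀ x ∈ Icc a b, κ * wt a b x ≤ w x := fun x hx =>
    ge_of_tendsto' (hlim x hx) fun n => hlow _ x hx
  have hwup : ∀ x ∈ Icc a b, ∀ η > 0, w x ≤ η + η ^ (-α) * ψ x := fun x hx η hη =>
    le_of_tendsto' (hlim x hx) fun n => hup _ x hx η hη
  have hmain : ∀ c d, a ≤ c → c < d → d ≤ b →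
      IntervalIntegrable (fun t => K t * wt a b t ^ (-α)) volume c d →
      IntervalIntegrable (fun t => K t * w t ^ (-α) - lam * M t * w t ^ (-γ)) volume c d ∧
      GreenRep c d (fun t => K t * w t ^ (-α) - lam * M t * w t ^ (-γ)) w := by
    intro c d hac hcd hdb hi
    refine GreenRep.of_tendsto hcd (fun n => (hrep (φ n)).mono hac hcd hdb (hhi (φ n)))
      (fun n => hmono hac hcd hdb (hhi (φ n))) (hgi c d hac hcd hdb hi)
      (fun n t ht => hbound (φ n) t ⟨hac.trans_lt ht.1, ht.2.trans_le hdb⟩) ?_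
      (fun x hx => hlim x ⟨hac.trans hx.1, hx.2.trans hdb⟩)
    intro t ht
    have ht' : t ∈ Ioo a b := ⟨hac.trans_lt ht.1, ht.2.trans_le hdb⟩
    have hl := hwlow t (Ioo_subset_Icc_self ht')
    have hs := hlim t (Ioo_subset_Icc_self ht')
    simp only [mul_assoc lam]
    exact (tendsto_cutTerm hφ ht' hκ hs hl).sub ((tendsto_cutTerm hφ ht' hκ hs hl).const_mul lam)
  have hψc : ContinuousOn ψ (Icc a b) := (greenRep_greenPot hab K).continuousOn hab hKi
  -- Continuity at the endpoints without any control of `K δ^(-α)`: take `η = ε / 2` in the upper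
  -- bound and use that `G K` is continuous and vanishes there.
  have hbdry : ∀ x ∈ Icc a b, w x = 0 → ψ x = 0 → ContinuousWithinAt w (Icc a b) x := by
    intro x hx hwx hψx
    rw [Metric.continuousWithinAt_iff']
    intro ε hε
    have hη : 0 < ε / 2 := by positivity
    have h1 : Tendsto (fun y => ε / 2 + (ε / 2) ^ (-α) * ψ y) (𝓝[Icc a b] x)
        (𝓝 (ε / 2 + (ε / 2) ^ (-α) * ψ x)) := ((hψc x hx).const_mul _).const_add _
    have h2 := h1.eventually_lt_const
      (show ε / 2 + (ε / 2) ^ (-α) * ψ x < ε by rw [hψx]; linarith)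
    filter_upwards [h2, self_mem_nhdsWithin] with y hy hym
    rw [hwx, Real.dist_eq, sub_zero, abs_of_nonneg
      ((mul_nonneg hκ.le (wt_nonneg a b y)).trans (hwlow y hym))]
    exact (hwup y hym _ hη).trans_lt hy
  refine ⟨w, hwa, hwb, fun x hx => ?_, hwlow, hmain⟩
  rcases hx.1.eq_or_lt with rfl | h1
  · exact hbdry _ hx hwa (greenPot_left hab K)
  rcases hx.2.eq_or_lt with rfl | h2
  · exact hbdry _ hx hwb (greenPot_right hab K)
  obtain ⟨c, hac, hcx⟩ := exists_between h1
  obtain ⟨d, hxd, hdb⟩ := exists_between h2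
  have hcd := hcx.trans hxd
  obtain ⟨hi, hr⟩ := hmain c d hac.le hcd hdb.le (intervalIntegrable_mul_wt_rpow hKi hac hcd hdb)
  exact ((hr.continuousOn hcd hi).continuousAt (Icc_mem_nhds hcx hxd)).continuousWithinAt

/-! ### Weak formulation, Sobolev regularity and the interior of the cone -/

theorem exists_Icc_of_isCompact {a b : ℝ} (hab : a < b) {S : Set ℝ} (hS : IsCompact S)
    (hSab : S ⊆ Ioo a b) : ∃ c d, a < c ∧ c < d ∧ d < b ∧ S ⊆ Ioo c d := by
  rcases S.eq_empty_or_nonempty with rfl | hne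
  · obtain ⟨c, hac, hcb⟩ := exists_between hab
    obtain ⟨d, hcd, hdb⟩ := exists_between hcb
    exact ⟨c, d, hac, hcd, hdb, empty_subset _⟩
  · obtain ⟨m, hm, hmin⟩ := hS.exists_isLeast hne
    obtain ⟨n, hn, hmax⟩ := hS.exists_isGreatest hne
    obtain ⟨c, hac, hcm⟩ := exists_between (hSab hm).1
    obtain ⟨d, hnd, hdb⟩ := exists_between (hSab hn).2
    exact ⟨c, d, hac, hcm.trans_le ((hmin hn).trans hnd.le), hdb, fun x hx =>
      ⟨hcm.trans_le (hmin hx), (hmax hx).trans_lt hnd⟩⟩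

theorem IsTestFunction.eq_zero {a b x : ℝ} {φ : ℝ → ℝ} (hφ : IsTestFunction a b φ)
    (hx : x ∉ Ioo a b) : φ x = 0 :=
  image_eq_zero_of_notMem_tsupport fun h => hx (hφ.support_subset h)

theorem setIntegral_Ioo_eq_intervalIntegral {a b : ℝ} (hab : a ≤ b) (f : ℝ → ℝ) :
    ∫ x in Ioo a b, f x = ∫ x in a..b, f x := by
  rw [intervalIntegral.integral_of_le hab, integral_Ioc_eq_integral_Ioo]

/-- A function that satisfies Green's formula on all compact subintervals solves the
equation in the sense of distributions. -/
theorem weak_of_greenRep {a b : ℝ} {f u φ : ℝ → ℝ} (hab : a < b)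
    (H : ∀ c d, a < c → c < d → d < b → IntervalIntegrable f volume c d ∧ GreenRep c d f u)
    (hφ : IsTestFunction a b φ) :
    ∫ x in Ioo a b, deriv u x * deriv φ x = ∫ x in Ioo a b, f x * φ x := by
  obtain ⟨c, d, hac, hcd, hdb, hsub⟩ :=
    exists_Icc_of_isCompact hab hφ.compact_support.isCompact hφ.support_subset
  have hcdab : Ioo c d ⊆ Ioo a b := Ioo_subset_Ioo hac.le hdb.le
  obtain ⟨hf, hrep⟩ := H c d hac hcd hdb
  obtain ⟨B, hB⟩ := hrep.exists_deriv hcd hf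
  have hφ0 : ∀ x ∉ Ioo c d, φ x = 0 := fun x hx =>
    image_eq_zero_of_notMem_tsupport fun h => hx (hsub h)
  have hφ1 : ∀ x ∉ Ioo c d, deriv φ x = 0 := fun x hx =>
    image_eq_zero_of_notMem_tsupport (f := deriv φ) fun h =>
      hx (hsub (tsupport_deriv_subset h))
  have e1 : ∫ x in Ioo a b, deriv u x * deriv φ x = ∫ x in Ioo c d, deriv u x * deriv φ x :=
    setIntegral_eq_of_subset_of_forall_sdiff_eq_zero measurableSet_Ioo hcdab fun x hx => by
      rw [hφ1 x hx.2, mul_zero]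
  have e2 : ∫ x in Ioo a b, f x * φ x = ∫ x in Ioo c d, f x * φ x :=
    setIntegral_eq_of_subset_of_forall_sdiff_eq_zero measurableSet_Ioo hcdab fun x hx => by
      rw [hφ0 x hx.2, mul_zero]
  have e3 : ∫ x in Ioo c d, deriv u x * deriv φ x =
      ∫ x in Ioo c d, (B - ∫ t in c..x, f t) * deriv φ x :=
    setIntegral_congr_fun measurableSet_Ioo fun x hx => by
      simp only [((hB x (Ioo_subset_Icc_self hx)).hasDerivAt (Icc_mem_nhds hx.1 hx.2)).deriv]
  rw [e1, e2, e3, setIntegral_Ioo_eq_intervalIntegral hcd.le,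
    setIntegral_Ioo_eq_intervalIntegral hcd.le]
  exact integral_primitive_mul_deriv hf (hφ.smooth.of_le (by simp)) (hφ0 c (by simp))
    (hφ0 d (by simp))

theorem contDiffOn_of_greenRep {a b : ℝ} {f u : ℝ → ℝ}
    (H : ∀ c d, a < c → c < d → d < b → IntervalIntegrable f volume c d ∧ GreenRep c d f u) :
    ContDiffOn ℝ 1 u (Ioo a b) := by
  have key : ∀ x ∈ Ioo a b, DifferentiableAt ℝ u x ∧ ContinuousAt (deriv u) x := by
    intro x hx
    obtain ⟨c, hac, hcx⟩ := exists_between hx.1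
    obtain ⟨d, hxd, hdb⟩ := exists_between hx.2
    have hcd := hcx.trans hxd
    obtain ⟨hf, hrep⟩ := H c d hac hcd hdb
    obtain ⟨B, hB⟩ := hrep.exists_deriv hcd hf
    have hd : ∀ y ∈ Ioo c d, HasDerivAt u (B - ∫ t in c..y, f t) y := fun y hy =>
      (hB y (Ioo_subset_Icc_self hy)).hasDerivAt (Icc_mem_nhds hy.1 hy.2)
    refine ⟨(hd x ⟨hcx, hxd⟩).differentiableAt, ?_⟩
    have hc : ContinuousOn (fun y => B - ∫ t in c..y, f t) (Icc c d) := by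
      have := intervalIntegral.continuousOn_primitive_interval' hf left_mem_uIcc
      rw [uIcc_of_le hcd.le] at this
      exact continuousOn_const.sub this
    refine (hc.continuousAt (Icc_mem_nhds hcx hxd)).congr ?_
    filter_upwards [Ioo_mem_nhds hcx hxd] with y hy
    exact (hd y hy).deriv.symm
  rw [show (1 : WithTop ℕ∞) = 0 + 1 by simp, contDiffOn_succ_iff_deriv_of_isOpen isOpen_Ioo]
  refine ⟨fun x hx => (key x hx).1.differentiableWithinAt, by simp, ?_⟩
  exact contDiffOn_zero.2 fun x hx => (key x hx).2.continuousWithinAt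

theorem memLp_vol_of_continuousOn {a b : ℝ} {f : ℝ → ℝ} (hf : ContinuousOn f (Icc a b))
    (q : ℝ≥0∞) : MemLp f q (vol a b) := by
  obtain ⟨C, hC⟩ := isCompact_Icc.exists_bound_of_continuousOn hf
  have : IsFiniteMeasure (vol a b) := by unfold vol; infer_instance
  refine MemLp.of_bound ((hf.mono Ioo_subset_Icc_self).aestronglyMeasurable measurableSet_Ioo) C ?_
  rw [vol]
  filter_upwards [ae_restrict_mem measurableSet_Ioo] with x hx
  exact hC x (Ioo_subset_Icc_self hx)

theorem memW2_of_hasDerivWithinAt {a b B : ℝ} {f u : ℝ → ℝ} (hab : a < b) {q : ℝ≥0∞} (hq : 1 ≤ q)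
    (hf : MemLp f q (vol a b)) (hua : u a = 0)
    (hB : ∀ x ∈ Icc a b, HasDerivWithinAt u (B - ∫ t in a..x, f t) (Icc a b) x) :
    MemW2 a b q u := by
  have : IsFiniteMeasure (vol a b) := by unfold vol; infer_instance
  have hfi : IntegrableOn f (Ioo a b) := hf.integrable hq
  have hfii : IntervalIntegrable f volume a b :=
    (intervalIntegrable_iff_integrableOn_Ioo_of_le hab.le).2 hfi
  have huc : ContinuousOn u (Icc a b) := fun x hx => (hB x hx).continuousWithinAt
  set P : ℝ → ℝ := fun x => B - ∫ t in a..x, f t with hP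
  have hPc : ContinuousOn P (Icc a b) := by
    have := intervalIntegral.continuousOn_primitive_interval' hfii left_mem_uIcc
    rw [uIcc_of_le hab.le] at this
    exact continuousOn_const.sub this
  have hPi : IntervalIntegrable P volume a b := by
    rw [← uIcc_of_le hab.le] at hPc
    exact hPc.intervalIntegrable
  -- Written in this form, `u` and its derivative `P` are both covered by
  -- `integral_primitive_mul_deriv`.
  have hu : ∀ x ∈ Icc a b, u x = 0 - ∫ t in a..x, -P t := by
    intro x hx
    have := intervalIntegral.integral_eq_sub_of_hasDerivAt_of_le hx.1
      (huc.mono (Icc_subset_Icc le_rfl hx.2)) (f' := P) (fun y hy =>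
        (hB y ⟨hy.1.le, hy.2.le.trans hx.2⟩).hasDerivAt
          (Icc_mem_nhds hy.1 (hy.2.trans_le hx.2)))
      (hPi.mono_set (by
        rw [uIcc_of_le hx.1, uIcc_of_le hab.le]; exact Icc_subset_Icc le_rfl hx.2))
    rw [intervalIntegral.integral_neg, this, hua]
    ring
  refine ⟨memLp_vol_of_continuousOn huc q, P, fun x => -f x, memLp_vol_of_continuousOn hPc q,
    hf.neg, ⟨?_, ?_, ?_⟩, ⟨?_, ?_, ?_⟩⟩
  · exact (huc.mono Ioo_subset_Icc_self).locallyIntegrableOn measurableSet_Ioo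
  · exact (hPc.mono Ioo_subset_Icc_self).locallyIntegrableOn measurableSet_Ioo
  · intro φ hφ
    have h1 := integral_primitive_mul_deriv (B := 0) hPi.neg
      (hφ.smooth.of_le (by simp)) (hφ.eq_zero (by simp)) (hφ.eq_zero (by simp))
    rw [setIntegral_Ioo_eq_intervalIntegral hab.le, setIntegral_Ioo_eq_intervalIntegral hab.le,
      ← intervalIntegral.integral_neg]
    rw [intervalIntegral.integral_congr (g := fun x => (0 - ∫ t in a..x, -P t) * deriv φ x)]
    · simpa only [Pi.neg_apply, neg_mul] using h1
    · intro x hx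
      rw [uIcc_of_le hab.le] at hx
      simp only [← hu x hx]
  · exact (hPc.mono Ioo_subset_Icc_self).locallyIntegrableOn measurableSet_Ioo
  · exact hfi.neg.locallyIntegrableOn
  · intro φ hφ
    have h1 := integral_primitive_mul_deriv (B := B) hfii
      (hφ.smooth.of_le (by simp)) (hφ.eq_zero (by simp)) (hφ.eq_zero (by simp))
    rw [setIntegral_Ioo_eq_intervalIntegral hab.le, setIntegral_Ioo_eq_intervalIntegral hab.le,
      ← intervalIntegral.integral_neg]
    simpa only [neg_mul, neg_neg] using h1

theorem extend_subtype_val_apply {a b x : ℝ} (p : C(Icc a b, ℝ)) (hx : x ∈ Icc a b) :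
    Function.extend Subtype.val p 0 x = p ⟨x, hx⟩ :=
  Subtype.val_injective.extend_apply p 0 ⟨x, hx⟩

/-- A `C¹` function that dominates a positive multiple of the distance to the boundary is in the
interior of the positive cone. -/
theorem memPInt_of_le {a b κ : ℝ} {u P : ℝ → ℝ} (hκ : 0 < κ) (hab : a < b)
    (hP : ContinuousOn P (Icc a b)) (hu : ∀ x ∈ Icc a b, HasDerivWithinAt u (P x) (Icc a b) x)
    (hua : u a = 0) (hub : u b = 0) (hlow : ∀ x ∈ Icc a b, κ * wt a b x ≤ u x) :
    MemPInt a b u := by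
  have huc : ContinuousOn u (Icc a b) := fun x hx => (hu x hx).continuousWithinAt
  let p₁ : C(Icc a b, ℝ) := ⟨_, huc.domRestrict⟩
  let p₂ : C(Icc a b, ℝ) := ⟨_, hP.domRestrict⟩
  have hp : (p₁, p₂) ∈ C1Zero a b := by
    refine ⟨fun x hx => ?_, fun x => ?_⟩
    · rcases hx with hx | hx
      · change u x = 0
        rw [hx, hua]
      · change u x = 0
        rw [hx, hub]
    · exact (hu x x.2).congr (fun y hy => extend_subtype_val_apply p₁ hy)
        (extend_subtype_val_apply p₁ x.2)
  refine ⟨⟨(p₁, p₂), hp⟩, ?_, fun x => rfl⟩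
  rw [mem_interior_iff_mem_nhds, Metric.mem_nhds_iff]
  -- If the derivatives differ by at most `κ`, integrating from the nearer endpoint, where both
  -- functions vanish, shows that the functions differ by at most `κ δ ≤ u`.
  refine ⟨κ, hκ, fun v hv => ?_⟩
  obtain ⟨⟨v₁, v₂⟩, hv0, hvd⟩ := v
  have hdist : dist v₂ p₂ < κ := (le_max_right _ _).trans_lt hv
  have hz : ∀ x ∈ Icc a b, HasDerivWithinAt
      (fun y => Function.extend Subtype.val v₁ 0 y - Function.extend Subtype.val p₁ 0 y)
      (IccExtend hab.le v₂ x - IccExtend hab.le p₂ x) (Icc a b) x := by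
    intro x hx
    rw [IccExtend_of_mem _ _ hx, IccExtend_of_mem _ _ hx]
    exact (hvd ⟨x, hx⟩).sub (hp.2 ⟨x, hx⟩)
  have hbd : ∀ x ∈ Icc a b, ‖IccExtend hab.le v₂ x - IccExtend hab.le p₂ x‖ ≤ κ := by
    intro x hx
    rw [← dist_eq_norm]
    exact (ContinuousMap.dist_apply_le_dist (f := v₂) (g := p₂) _).trans hdist.le
  have hL := fun {x y : ℝ} (hx : x ∈ Icc a b) (hy : y ∈ Icc a b) =>
    Convex.norm_image_sub_le_of_norm_hasDerivWithin_le hz hbd (convex_Icc a b) hx hy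
  intro x
  obtain ⟨x, hx⟩ := x
  have ha : a ∈ Icc a b := ⟨le_rfl, hab.le⟩
  have hb : b ∈ Icc a b := ⟨hab.le, le_rfl⟩
  have h1 := hL ha hx
  have h2 := hL hb hx
  simp only [extend_subtype_val_apply _ hx, extend_subtype_val_apply _ ha,
    extend_subtype_val_apply _ hb, hv0 ⟨a, ha⟩ (Or.inl rfl), hv0 ⟨b, hb⟩ (Or.inr rfl),
    hp.1 ⟨a, ha⟩ (Or.inl rfl), hp.1 ⟨b, hb⟩ (Or.inr rfl), sub_zero, Real.norm_eq_abs] at h1 h2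
  rw [abs_of_nonneg (show 0 ≤ x - a by linarith [hx.1])] at h1
  rw [abs_of_nonpos (show x - b ≤ 0 by linarith [hx.2])] at h2
  have h3 := hlow x hx
  have h4 : p₁ ⟨x, hx⟩ = u x := rfl
  rw [h4] at h1 h2
  change 0 ≤ v₁ ⟨x, hx⟩
  rw [wt_eq hx] at h3
  rcases min_choice (x - a) (b - x) with h | h <;> rw [h] at h3
  · linarith [(abs_le.1 h1).1]
  · linarith [(abs_le.1 h2).1]

/-! ### Solvability from the integrability of `M δ^(-γ)` -/

theorem solvableForSmall_of_measurable {a b α γ : ℝ} {K M : ℝ → ℝ} {s : ℝ≥0∞} (hab : a < b)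
    (hK : Measurable K) (hM : Measurable M) (hK0 : ∀ t, 0 ≤ K t) (hM0 : ∀ t, 0 ≤ M t)
    (hα : 0 < α) (hγ : 0 < γ) (hKne : ¬ K =ᵐ[vol a b] 0) (hKi : Integrable K (vol a b))
    (hs : 1 < s) (hMs : MemLp (fun t => M t * wt a b t ^ (-γ)) s (vol a b)) :
    SolvableForSmall a b K M α γ := by
  have hfin : IsFiniteMeasure (vol a b) := by unfold vol; infer_instance
  have hKii : IntervalIntegrable K volume a b :=
    (intervalIntegrable_iff_integrableOn_Ioo_of_le hab.le).2 hKi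
  have hMii : IntervalIntegrable (fun t => M t * wt a b t ^ (-γ)) volume a b :=
    (intervalIntegrable_iff_integrableOn_Ioo_of_le hab.le).2 (hMs.integrable hs.le)
  obtain ⟨κ, hκ, lam₀, hlam₀, H⟩ :=
    exists_greenRep_solution hab hK hM hK0 hM0 hα hγ hKne hKii hMii
  refine ⟨lam₀, hlam₀, fun lam hlam hle => ?_⟩
  obtain ⟨u, hua, hub, huc, hlow, hu⟩ := H lam hlam hle
  have hloc : ∀ c d, a < c → c < d → d < b →
      IntervalIntegrable (fun t => K t * u t ^ (-α) - lam * M t * u t ^ (-γ)) volume c d ∧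
      GreenRep c d (fun t => K t * u t ^ (-α) - lam * M t * u t ^ (-γ)) u :=
    fun c d hac hcd hdb => hu c d hac.le hcd hdb.le (intervalIntegrable_mul_wt_rpow hKii hac hcd hdb)
  have hpos : ∀ x ∈ Ioo a b, 0 < u x := fun x hx =>
    (mul_pos hκ (wt_pos hx)).trans_le (hlow x (Ioo_subset_Icc_self hx))
  refine ⟨u, ⟨contDiffOn_of_greenRep hloc, huc, hpos, hua, hub,
    fun φ hφ => weak_of_greenRep hab hloc hφ⟩, ?_⟩
  rintro ⟨r, hr, hKr⟩
  have hKr' : MemLp (fun t => K t * wt a b t ^ (-α)) r (vol a b) := by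
    refine (memLp_congr_ae ?_).1 hKr
    rw [vol]
    filter_upwards [ae_restrict_mem measurableSet_Ioo] with x hx
    rw [bdist_eq_wt hab (Ioo_subset_Icc_self hx)]
  have hKai : IntervalIntegrable (fun t => K t * wt a b t ^ (-α)) volume a b :=
    (intervalIntegrable_iff_integrableOn_Ioo_of_le hab.le).2 (hKr'.integrable hr.le)
  obtain ⟨hfi, hrep⟩ := hu a b le_rfl hab le_rfl hKai
  set f : ℝ → ℝ := fun t => K t * u t ^ (-α) - lam * M t * u t ^ (-γ) with hf
  have hq : 1 < min r s := lt_min hr hs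
  have hfq : MemLp f (min r s) (vol a b) := by
    have h1 : MemLp (fun t => κ ^ (-α) * (K t * wt a b t ^ (-α)) +
        lam * κ ^ (-γ) * (M t * wt a b t ^ (-γ))) (min r s) (vol a b) :=
      ((hKr'.mono_exponent (min_le_left r s)).const_mul _).add
        ((hMs.mono_exponent (min_le_right r s)).const_mul _)
    refine h1.mono'
      ((intervalIntegrable_iff_integrableOn_Ioo_of_le hab.le).1 hfi).aestronglyMeasurable ?_
    rw [vol]
    filter_upwards [ae_restrict_mem measurableSet_Ioo] with x hx
    have hw := wt_pos hx
    have hl := hlow x (Ioo_subset_Icc_self hx)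
    have hpw : ∀ β : ℝ, 0 < β → u x ^ (-β) ≤ κ ^ (-β) * wt a b x ^ (-β) := fun β hβ => by
      rw [← Real.mul_rpow hκ.le hw.le]
      exact Real.rpow_le_rpow_of_nonpos (by positivity) hl (by linarith)
    have hnn : ∀ β : ℝ, 0 ≤ u x ^ (-β) := fun β => Real.rpow_nonneg (hpos x hx).le _
    have hn1 := mul_nonneg (hK0 x) (hnn α)
    have hn2 := mul_nonneg (mul_nonneg hlam.le (hM0 x)) (hnn γ)
    have hb1 := mul_le_mul_of_nonneg_left (hpw α hα) (hK0 x)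
    have hb2 := mul_le_mul_of_nonneg_left (hpw γ hγ) (mul_nonneg hlam.le (hM0 x))
    rw [Real.norm_eq_abs]
    refine (abs_sub _ _).trans ?_
    rw [abs_of_nonneg hn1, abs_of_nonneg hn2]
    linarith
  obtain ⟨B, hB⟩ := hrep.exists_deriv hab hfi
  refine ⟨min r s, hq, memW2_of_hasDerivWithinAt hab hq.le hfq hua hB,
    memPInt_of_le hκ hab ?_ hB hua hub hlow⟩
  have := intervalIntegral.continuousOn_primitive_interval' hfi left_mem_uIcc
  rw [uIcc_of_le hab.le] at this
  exact continuousOn_const.sub this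

/-- `K` and `M` enter only through integrals and `L^r` membership, so they may be replaced by Borel
representatives that are nonnegative everywhere. -/
theorem SolvableForSmall.congr {a b α γ : ℝ} {K K' M M' : ℝ → ℝ}
    (h : SolvableForSmall a b K M α γ) (hK : K =ᵐ[vol a b] K') (hM : M =ᵐ[vol a b] M') :
    SolvableForSmall a b K' M' α γ := by
  obtain ⟨lam₀, hlam₀, H⟩ := h
  refine ⟨lam₀, hlam₀, fun lam hlam hle => ?_⟩
  obtain ⟨u, hu, hreg⟩ := H lam hlam hle
  refine ⟨u, ⟨hu.contDiffOn, hu.continuousOn, hu.pos, hu.left_eq_zero, hu.right_eq_zero,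
    fun φ hφ => ?_⟩, ?_⟩
  · rw [hu.weak φ hφ]
    refine integral_congr_ae ?_
    rw [vol] at hK hM
    filter_upwards [hK, hM] with x h1 h2
    rw [h1, h2]
  · rintro ⟨r, hr, hr'⟩
    refine hreg ⟨r, hr, (memLp_congr_ae ?_).1 hr'⟩
    filter_upwards [hK] with x h1
    rw [h1]

theorem memLp_wt_rpow {a b γ q : ℝ} (hab : a < b) (hq : 0 < q) (hγq : γ * q < 1) :
    MemLp (fun t => wt a b t ^ (-γ)) (ENNReal.ofReal q) (vol a b) := by
  have hm : Measurable fun t => wt a b t ^ (-γ) :=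
    (continuous_wt a b).measurable.pow_const _
  rw [← integrable_norm_rpow_iff hm.aestronglyMeasurable (by simpa using hq) ENNReal.ofReal_ne_top,
    ENNReal.toReal_ofReal hq.le]
  have h0 : -1 < -(γ * q) := by linarith
  have h1 : IntervalIntegrable (fun t => (t - a) ^ (-(γ * q))) volume a b := by
    have := (intervalIntegral.intervalIntegrable_rpow' (a := 0) (b := b - a) h0).comp_sub_right a
    simpa using this
  have h2 : IntervalIntegrable (fun t => (b - t) ^ (-(γ * q))) volume a b := by
    have := (intervalIntegral.intervalIntegrable_rpow' (a := b - a) (b := 0) h0).comp_sub_left b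
    simpa using this
  have h3 : Integrable (fun t => (t - a) ^ (-(γ * q)) + (b - t) ^ (-(γ * q))) (vol a b) :=
    (intervalIntegrable_iff_integrableOn_Ioo_of_le hab.le).1 (h1.add h2)
  refine h3.mono' (hm.norm.pow_const q).aestronglyMeasurable ?_
  rw [vol]
  filter_upwards [ae_restrict_mem measurableSet_Ioo] with x hx
  have hw := wt_pos hx
  have e : ‖wt a b x ^ (-γ)‖ ^ q = wt a b x ^ (-(γ * q)) := by
    rw [Real.norm_of_nonneg (by positivity), ← Real.rpow_mul hw.le]
    ring_nf
  rw [e, Real.norm_of_nonneg (by positivity), wt_eq (Ioo_subset_Icc_self hx)]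
  have p1 : 0 ≤ (x - a) ^ (-(γ * q)) := Real.rpow_nonneg (by linarith [hx.1]) _
  have p2 : 0 ≤ (b - x) ^ (-(γ * q)) := Real.rpow_nonneg (by linarith [hx.2]) _
  rcases min_choice (x - a) (b - x) with h | h <;> rw [h] <;> linarith

/-- Hölder with an exponent `q` strictly between `p'` and `1 / γ`: `γ q < 1` gives `δ^(-γ) ∈ L^q`,
and `q > p'` gives `1 / s = 1 / p + 1 / q < 1`. -/
theorem exists_memLp_mul_wt {a b γ : ℝ} {p : ℝ≥0∞} {M : ℝ → ℝ} (hab : a < b) (hp : 2 ≤ p)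
    (hM : MemLp M p (vol a b)) (hγ : 0 < γ) (hγp : γ < 1 / conj p) :
    ∃ s : ℝ≥0∞, 1 < s ∧ MemLp (fun t => M t * wt a b t ^ (-γ)) s (vol a b) := by
  have hp1 : 1 < p := lt_of_lt_of_le (by norm_num) hp
  have hc := ENNReal.HolderConjugate.conjExponent hp1.le
  have hctop : ENNReal.conjExponent p ≠ ⊤ := by
    simp [ENNReal.conjExponent, tsub_eq_zero_iff_le, hp1]
  have hc0 : 0 < conj p := by
    by_contra! h
    have h1 : 1 / conj p ≤ 0 := div_nonpos_of_nonneg_of_nonpos zero_le_one h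
    linarith
  obtain ⟨q, hq1, hq2⟩ := exists_between ((lt_one_div hγ hc0).1 hγp)
  have hq0 : 0 < q := hc0.trans hq1
  have hcq : ENNReal.conjExponent p < ENNReal.ofReal q :=
    (ENNReal.lt_ofReal_iff_toReal_lt hctop).2 hq1
  have hqm := memLp_wt_rpow hab hq0 (by rwa [lt_div_iff₀ hγ, mul_comm] at hq2)
  have : ENNReal.HolderTriple p (ENNReal.ofReal q) (p⁻¹ + (ENNReal.ofReal q)⁻¹)⁻¹ :=
    ⟨(inv_inv _).symm⟩
  refine ⟨(p⁻¹ + (ENNReal.ofReal q)⁻¹)⁻¹, ?_, hqm.mul hM⟩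
  rw [ENNReal.one_lt_inv, ← hc.inv_add_inv_eq_one]
  exact ENNReal.add_lt_add_left (by simpa using (zero_lt_one.trans hp1).ne')
    (ENNReal.inv_lt_inv.2 hcq)

/-- Solvability for small `lam` needs only `M ∈ L^p(Ω)` with `γ < 1 / p'`. No bound on the size of
`M` is required: replacing `M` by a multiple `t M`, `t > 0`, amounts to rescaling `lam`, so that the
assertion for `M` and the one for `t M` are equivalent. -/
theorem solvableForSmall_of_memLp {a b α γ : ℝ} {p : ℝ≥0∞} {K M : ℝ → ℝ} (hab : a < b)
    (hK : MemLp K 2 (vol a b)) (hK_nonneg : ∀ᵐ x ∂(vol a b), 0 ≤ K x)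
    (hM_nonneg : ∀ᵐ x ∂(vol a b), 0 ≤ M x) (hK_ne : ¬ K =ᵐ[vol a b] 0)
    (hp : 2 ≤ p) (hM : MemLp M p (vol a b)) (hγ : 0 < γ) (hγp : γ < 1 / conj p) (hα : 0 < α) :
    SolvableForSmall a b K M α γ := by
  have hfin : IsFiniteMeasure (vol a b) := by unfold vol; infer_instance
  have key : ∀ {f : ℝ → ℝ}, AEStronglyMeasurable f (vol a b) → (∀ᵐ x ∂(vol a b), 0 ≤ f x) →
      ∃ g : ℝ → ℝ, Measurable g ∧ (∀ t, 0 ≤ g t) ∧ g =ᵐ[vol a b] f := fun {f} hf h0 =>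
    ⟨fun t => |hf.mk f t|, hf.stronglyMeasurable_mk.measurable.abs, fun t => abs_nonneg _, by
      filter_upwards [hf.ae_eq_mk, h0] with x h1 h2
      rw [← h1, abs_of_nonneg h2]⟩
  obtain ⟨K', hK'm, hK'0, hK'⟩ := key hK.1 hK_nonneg
  obtain ⟨M', hM'm, hM'0, hM'⟩ := key hM.1 hM_nonneg
  obtain ⟨s, hs, hMs⟩ := exists_memLp_mul_wt hab hp ((memLp_congr_ae hM').2 hM) hγ hγp
  have hK'i : Integrable K' (vol a b) :=
    ((memLp_congr_ae hK').2 hK).integrable (by norm_num)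
  exact (solvableForSmall_of_measurable hab hK'm hM'm hK'0 hM'0 hα hγ
    (fun h => hK_ne (hK'.symm.trans h)) hK'i hs hMs).congr hK' hM'

end SingularBVP

theorem mainTheorem4 (a b : ℝ) (hab : a < b) (K M : ℝ → ℝ)
    (hK : MemLp K 2 (SingularBVP.vol a b)) (hM : MemLp M 2 (SingularBVP.vol a b))
    (hK_nonneg : ∀ᵐ x ∂(SingularBVP.vol a b), 0 ≤ K x)
    (hM_nonneg : ∀ᵐ x ∂(SingularBVP.vol a b), 0 ≤ M x)
    (hK_ne : ¬ K =ᵐ[SingularBVP.vol a b] 0) :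
    (∀ (p : ℝ≥0∞) (γ : ℝ), 2 ≤ p → MemLp M p (SingularBVP.vol a b) →
      0 < γ → γ < 1 / SingularBVP.conj p →
      max (lpNorm (fun x => (x - a) * M x) p (SingularBVP.vol a b))
          (lpNorm (fun x => (b - x) * M x) p (SingularBVP.vol a b)) ≤
        SingularBVP.smallConst γ p a b *
          ((∫ x in Ioo a b, K x * SingularBVP.bdist a b x) ^ (1 + γ) /
            (∫ x in Ioo a b, K x) ^ γ) →
      ∀ α : ℝ, γ < α → SingularBVP.SolvableForSmall a b K M α γ) ∧
    (max (∫ x in Ioo a b, (x - a) * M x) (∫ x in Ioo a b, (b - x) * M x) <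
        ∫ x in Ioo a b, K x * SingularBVP.bdist a b x →
      ∃ γ₀ : ℝ, 0 < γ₀ ∧ ∀ γ : ℝ, 0 < γ → γ ≤ γ₀ →
        ∀ α : ℝ, γ < α → SingularBVP.SolvableForSmall a b K M α γ) := by
  refine ⟨fun p γ hp hMp hγ hγp _ α hα => ?_,
    -- Since `M ∈ L²` and the conjugate of `2` is `2`, any `γ₀ < 1 / 2` would do.
    fun _ => ⟨1 / 4, by norm_num, fun γ hγ hγ₀ α hα => ?_⟩⟩
  · exact SingularBVP.solvableForSmall_of_memLp hab hK hK_nonneg hM_nonneg hK_ne hp hMp hγ hγp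
      (hγ.trans hα)
  · have h2 : SingularBVP.conj 2 = 2 := by
      have h : (2 : ℝ≥0∞) - 1 = 1 := by
        rw [← one_add_one_eq_two]
        simp
      rw [SingularBVP.conj, ENNReal.conjExponent, h]
      norm_num
    refine SingularBVP.solvableForSmall_of_memLp hab hK hK_nonneg hM_nonneg hK_ne le_rfl hM hγ ?_
      (hγ.trans hα)
    rw [h2]
    linarith
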